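/- **Setting.** Let $\mathcal W=\{w_1,\dots,w_L\}$ be internal signals, $\mathcal C\subseteq\mathcal W$ the measured ones, $c=|\mathcal C|$, and $\mathcal Z=\mathcal W\setminus\mathcal C$; order $w=(w_{\mathcal C},w_{\mathcal Z})$ and let $C=[I\ \ 0]$ be the matrix selecting $w_{\mathcal C}$. A network model set is $$\mathcal M=\Big\{\Big(G(q,\theta),\,R,\,C,\,\begin{bmatrix}\tilde H(q,\theta)\\0\end{bmatrix},\,\tilde\Lambda(\theta)\Big):\theta\in\Theta\subseteq\mathbb R^n\Big\},$$ describing $w=Gw+Rr+\begin{bmatrix}\tilde H\\0\end{bmatrix}\tilde e$ with $\tilde e$ white noise of covariance $\tilde\Lambda$. Here $R$ consists of $K$ distinct columns of the $L\times L$ identity matrix, and the entries of the $L\times L$ matrix $G$ and of the $c\times c$ matrix $\tilde H$ are real rational transfer functions: quotients of polynomials in $z$ whose coefficients are polynomials in $\theta$. For every $\theta\in\Theta$: $G$ is proper, stable (all poles in $|z|<1$) and has zero diagonal; $T=(I-G)^{-1}$ is stable; all principal minors of $\lim_{z\to\infty}(I-G(z))$ are nonzero; $\tilde H$ is proper, stable,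 monic ($\tilde H(\infty)=I$) and minimum phase (its inverse has no poles in $|z|>1$); $\tilde\Lambda$ is real positive semidefinite. Put $X=\big[R\ \ \begin{bmatrix}\tilde H\\0\end{bmatrix}\big]$ and $\Phi(\omega)=T\begin{bmatrix}\tilde H\\0\end{bmatrix}\tilde\Lambda\begin{bmatrix}\tilde H\\0\end{bmatrix}^{\star}T^{\star}$ evaluated at $z=e^{i\omega}$. Assume moreover: * for every $\theta\in\Theta$, $C\Phi(\omega)C^\top$ has full rank for almost all $\omega$; * different entries of $G$ and $\tilde H$ depend on disjoint sets of components of $\theta$; * either $G(q,\theta)$ is strictly proper for all $\theta\in\Theta$, or $\tilde\Lambda(\theta)$ is diagonal for all $\theta\in\Theta$ and there is one permutation matrix $P$ such that $PG(\infty,\theta)P^\top$ is lower triangular for all $\theta\in\Theta$; * every submatrix of $[\,G-I\ \ X\,]$ that does not depend on $\theta$ has rank equal to its structural rank, i.e. the maximal rank among matrices with the same nonzero pattern; * for every $\theta\in\Theta$, the transfer matrix $CT\begin{bmatrix}\tilde H\\0\end{bmatrix}$ from $\tilde e$ to $w_{\mathcal C}$ is minimum phase, so that it is a spectral factor of $C\Phi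 C^\top$ in the usual sense. **Graph.** An entry is *known* if it does not depend on $\theta\in\Theta$, and *unknown* otherwise. Let $\mathcal X$ be the set of all external signals (the components of $r$ and $\tilde e$). The directed graph of $\mathcal M$ has vertex set $\mathcal W\cup\mathcal X$, an edge $w_i\to w_j$ iff $G_{ji}$ is not fixed to zero, and an edge $x\to w_j$ iff $X_{jx}$ is not fixed to zero. Write $b_{\mathcal V_1\to\mathcal V_2}$ for the maximal number of pairwise vertex-disjoint directed paths from $\mathcal V_1$ to $\mathcal V_2$ (end vertices included; a single vertex is a path). Let $\mathcal X_j$ be the set of external signals without unknown edge to $w_j$, and let $\mathcal N_j^-$ be the set of in-neighbors of $w_j$ in $\mathcal W$ excluding those measured signals that have a known edge to $w_j$. **Claim.** Let $\mathcal N^\star\subseteq\mathcal N_j^-$. If for some $\bar{\mathcal X}\subseteq\mathcal X_j$ and $\bar{\mathcal C}\subseteq\mathcal C\setminus\mathcal N^\star$ 1. $b_{\bar{\mathcal X}\to\mathcal N_j^-\cup\bar{\mathcal C}}=b_{\bar{\mathcal X}\to(\mathcal N_j^-\setminus\mathcal N^\star)\cup\bar{\mathcal C}}+b_{\bar{\mathcal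 X}\to\mathcal N^\star}$ and $b_{\bar{\mathcal X}\to\mathcal N^\star}=|\mathcal N^\star|$, 2. $b_{\bar{\mathcal X}\to(\mathcal N_j^-\setminus\mathcal N^\star)\cup\bar{\mathcal C}}=b_{\bar{\mathcal X}\to\bar{\mathcal C}}$, 3. $\mathcal N^\star\cup\{w_j\}\subseteq\mathcal C$, then $G_{j\mathcal N^\star}$ is generically identifiable in $\mathcal M$ from $(w_{\mathcal C},r)$: for all $\theta_0\in\Theta$ outside a set of Lebesgue measure zero and for all $\theta_1\in\Theta$, if $CT(q,\theta_0)R=CT(q,\theta_1)R$ and $C\Phi(\omega,\theta_0)C^\top=C\Phi(\omega,\theta_1)C^\top$ for all $\omega$, then $G_{ji}(q,\theta_0)=G_{ji}(q,\theta_1)$ for every $w_i\in\mathcal N^\star$. -/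

import Mathlib

open MeasureTheory
open scoped Matrix

namespace DynNet

/-! ### Transfer functions

A (real, rational) transfer function is an element of `RatFunc ℝ`; the indeterminate `RatFunc.X`
is the forward shift `z` (or `q`). In `RatFunc`, numerator and denominator are coprime and the
denominator is monic. -/

/-- Properness: the value at `z = ∞` is finite. -/
def IsProper (f : RatFunc ℝ) : Prop := f.num.degree ≤ f.denom.degree

/-- Strict properness: the value at `z = ∞` is zero. -/
def IsStrictlyProper (f : RatFunc ℝ) : Prop := f.num.degree < f.denom.degree

/-- The value `lim_{z → ∞} f(z)` of a proper transfer function (the denominator is monic). -/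
noncomputable def atInfinity (f : RatFunc ℝ) : ℝ := f.num.coeff f.denom.natDegree

/-- `z` is a (finite) pole of `f`. -/
def IsPole (f : RatFunc ℝ) (z : ℂ) : Prop := Polynomial.aeval z f.denom = 0

/-- Stability (discrete time): all poles lie in the open unit disc. -/
def IsStable (f : RatFunc ℝ) : Prop := ∀ z : ℂ, IsPole f z → ‖z‖ < 1

/-- A square transfer matrix is minimum phase if it is invertible and its inverse has no poles
outside the closed unit disc. -/
def IsMinimumPhase {ι : Type*} [Fintype ι] [DecidableEq ι] (A : Matrix ι ι (RatFunc ℝ)) : Prop :=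
  A.det ≠ 0 ∧ ∀ (i k : ι) (z : ℂ), IsPole (A⁻¹ i k) z → ‖z‖ ≤ 1

/-- The frequency response `A(e^{iω})` of a transfer matrix. -/
noncomputable def freqResponse {ι κ : Type*} (A : Matrix ι κ (RatFunc ℝ)) (ω : ℝ) :
    Matrix ι κ ℂ :=
  A.map fun f => f.eval (algebraMap ℝ ℂ) (Complex.exp (Complex.I * ω))

/-- The structural rank: the maximum rank of all matrices with the same nonzero pattern. -/
noncomputable def structuralRank {F ι κ : Type*} [Field F] [Fintype κ] (A : Matrix ι κ F) : ℕ :=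
  sSup {r | ∃ B : Matrix ι κ F, (∀ i k, B i k = 0 ↔ A i k = 0) ∧ B.rank = r}

/-! ### Vertex disjoint paths in a directed graph -/

/-- `l` is the vertex sequence of a directed path from a vertex of `V₁` to a vertex of `V₂`
(no repeated vertices; a single vertex is a path). -/
def IsPathFromTo {V : Type*} (Adj : V → V → Prop) (V₁ V₂ : Set V) (l : List V) : Prop :=
  l.Nodup ∧ l.IsChain Adj ∧ (∃ a ∈ V₁, l.head? = some a) ∧ (∃ b ∈ V₂, l.getLast? = some b)

/-- The maximum number of pairwise vertex disjoint paths from `V₁` to `V₂`. -/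
noncomputable def maxDisjointPaths {V : Type*} (Adj : V → V → Prop) (V₁ V₂ : Set V) : ℕ :=
  sSup {k | ∃ P : Fin k → List V,
    (∀ a, IsPathFromTo Adj V₁ V₂ (P a)) ∧ ∀ a b, a ≠ b → (P a).Disjoint (P b)}

/-! ### Parameterized network model sets -/

/-- The data of a parameterized set of network models `(G(q,θ), R, C, [H̃(q,θ); 0], Λ̃(θ))`,
`θ ∈ Θ ⊆ ℝⁿ`, with internal signals indexed by `W` and measured excitation signals `r` indexed
by `K`. The values of `G`, `H`, `Λ` at parameters outside `Θ` play no role. -/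
structure ModelSet (W K : Type*) where
  /-- number of parameters -/
  n : ℕ
  /-- the parameter set -/
  Θ : Set (Fin n → ℝ)
  /-- the measured internal signals -/
  C : Finset W
  /-- `r p` enters the network at the internal signal `exc p` -/
  exc : K ↪ W
  /-- the modules; `G θ j i` is the module from `i` to `j` -/
  G : (Fin n → ℝ) → Matrix W W (RatFunc ℝ)
  /-- the noise model of the measured internal signals -/
  H : (Fin n → ℝ) → Matrix C C (RatFunc ℝ)
  /-- the covariance matrix of the white noise `ẽ` -/
  Λ : (Fin n → ℝ) → Matrix C C ℝ

namespace ModelSet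

variable {W K : Type*} [Fintype W] [DecidableEq W] (M : ModelSet W K)

/-- The external signals: `r` signals and `ẽ` signals. -/
abbrev Ext : Type _ := K ⊕ M.C

/-- The vertices of the graph: internal and external signals. -/
abbrev Vertex : Type _ := W ⊕ M.Ext

/-- The binary matrix `R`: distinct columns of the identity matrix. -/
noncomputable def R : Matrix W K (RatFunc ℝ) := Matrix.of fun i p => if i = M.exc p then 1 else 0

/-- The noise model `[H̃; 0]` of all internal signals. -/
noncomputable def Hp (θ : Fin M.n → ℝ) : Matrix W M.C (RatFunc ℝ) :=
  Matrix.of fun i k => if h : i ∈ M.C then M.H θ ⟨i, h⟩ k else 0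

/-- `X = [R  [H̃; 0]]`. -/
noncomputable def X (θ : Fin M.n → ℝ) : Matrix W M.Ext (RatFunc ℝ) := Matrix.fromCols M.R (M.Hp θ)

/-- `T = (I - G)⁻¹`. -/
noncomputable def T (θ : Fin M.n → ℝ) : Matrix W W (RatFunc ℝ) := (1 - M.G θ)⁻¹

/-- The rows of a matrix that belong to the measured internal signals (multiplication by the
selection matrix `C` from the left). -/
def measuredRows {κ α : Type*} (A : Matrix W κ α) : Matrix M.C κ α :=
  A.submatrix (fun i => (i : W)) id

/-- `C T R`. -/
noncomputable def CTR (θ : Fin M.n → ℝ) : Matrix M.C K (RatFunc ℝ) :=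
  M.measuredRows (M.T θ * M.R)

/-- `C T [H̃; 0]`, the transfer matrix from `ẽ` to the measured internal signals. -/
noncomputable def noiseTransfer (θ : Fin M.n → ℝ) : Matrix M.C M.C (RatFunc ℝ) :=
  M.measuredRows (M.T θ * M.Hp θ)

/-- The power spectrum
`Φ(ω) = [I - G(e^{iω})]⁻¹ H(e^{iω}) Λ H(e^{iω})^⋆ [I - G(e^{iω})]^{-⋆}` with `H = [H̃; 0]`. -/
noncomputable def spectrum (θ : Fin M.n → ℝ) (ω : ℝ) : Matrix W W ℂ :=
  (1 - freqResponse (M.G θ) ω)⁻¹ * freqResponse (M.Hp θ) ω * (M.Λ θ).map (algebraMap ℝ ℂ)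
    * (freqResponse (M.Hp θ) ω)ᴴ * ((1 - freqResponse (M.G θ) ω)⁻¹)ᴴ

/-- The spectrum `C Φ(ω) Cᵀ` of the measured internal signals. -/
noncomputable def measuredSpectrum (θ : Fin M.n → ℝ) (ω : ℝ) : Matrix M.C M.C ℂ :=
  (M.spectrum θ ω).submatrix (fun i => (i : W)) (fun i => (i : W))

/-- `G^∞(θ) = lim_{z → ∞} G(z, θ)`. -/
noncomputable def Ginf (θ : Fin M.n → ℝ) : Matrix W W ℝ := (M.G θ).map atInfinity

/-- A transfer function is rationally parameterized by the parameters in `S`: it is a quotient of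
two polynomials in `z` whose coefficients are polynomials in the parameters in `S`, the
denominator being nonzero for every `θ ∈ Θ`. -/
def RationalIn (S : Set (Fin M.n)) (f : (Fin M.n → ℝ) → RatFunc ℝ) : Prop :=
  ∃ a b : Polynomial (MvPolynomial (Fin M.n) ℝ),
    (∀ d, a.coeff d ∈ MvPolynomial.supported ℝ S ∧ b.coeff d ∈ MvPolynomial.supported ℝ S) ∧
    ∀ θ ∈ M.Θ, b.map (MvPolynomial.eval θ) ≠ 0 ∧
      f θ = algebraMap (Polynomial ℝ) (RatFunc ℝ) (a.map (MvPolynomial.eval θ)) /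
        algebraMap (Polynomial ℝ) (RatFunc ℝ) (b.map (MvPolynomial.eval θ))

/-- The requirements on a network model set: the transfer functions are parameterized rationally,
and every model of the set is a stable well-posed network whose noise model `H̃` is proper, stable,
minimum phase and monic. -/
structure IsNetworkModelSet : Prop where
  rational_G : ∀ i k, M.RationalIn Set.univ fun θ => M.G θ i k
  rational_H : ∀ i k, M.RationalIn Set.univ fun θ => M.H θ i k
  G_proper : ∀ θ ∈ M.Θ, ∀ i k, IsProper (M.G θ i k)
  G_stable : ∀ θ ∈ M.Θ, ∀ i k, IsStable (M.G θ i k)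
  G_hollow : ∀ θ ∈ M.Θ, ∀ i, M.G θ i i = 0
  T_stable : ∀ θ ∈ M.Θ, ∀ i k, IsStable (M.T θ i k)
  /-- all principal minors of `lim_{z → ∞} (I - G(z))` are nonzero -/
  wellPosed : ∀ θ ∈ M.Θ, ∀ s : Finset W,
    ((1 - M.Ginf θ).submatrix (fun i : s => (i : W)) (fun i : s => (i : W))).det ≠ 0
  H_proper : ∀ θ ∈ M.Θ, ∀ i k, IsProper (M.H θ i k)
  H_stable : ∀ θ ∈ M.Θ, ∀ i k, IsStable (M.H θ i k)
  H_minimumPhase : ∀ θ ∈ M.Θ, IsMinimumPhase (M.H θ)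
  H_monic : ∀ θ ∈ M.Θ, (M.H θ).map atInfinity = 1
  Λ_posSemidef : ∀ θ ∈ M.Θ, (M.Λ θ).PosSemidef

/-- `C Φ(ω) Cᵀ` has full rank for almost all `ω`. -/
def HasFullRankSpectrum : Prop :=
  ∀ θ ∈ M.Θ, ∀ᵐ ω : ℝ, (M.measuredSpectrum θ ω).rank = M.C.card

/-- The transfer functions are parameterized independently: different entries of `G` and `H̃`
depend on disjoint sets of parameters. -/
def IsIndependentlyParameterized : Prop :=
  ∃ S : (W × W) ⊕ (M.C × M.C) → Set (Fin M.n),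
    (∀ a b, a ≠ b → Disjoint (S a) (S b)) ∧
    (∀ i k, M.RationalIn (S (Sum.inl (i, k))) fun θ => M.G θ i k) ∧
    (∀ i k, M.RationalIn (S (Sum.inr (i, k))) fun θ => M.H θ i k)

/-- Either `G` is strictly proper, or `Λ̃` is diagonal and there are no algebraic loops: after a
permutation of the internal signals, `G^∞(θ)` is lower triangular. -/
def FeedthroughCondition : Prop :=
  (∀ θ ∈ M.Θ, ∀ i k, IsStrictlyProper (M.G θ i k)) ∨
  ((∀ θ ∈ M.Θ, (M.Λ θ).IsDiag) ∧
    ∃ σ : W ≃ Fin (Fintype.card W), ∀ θ ∈ M.Θ, ∀ i k, σ i < σ k → M.Ginf θ i k = 0)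

/-- A parameter-dependent object is known (fixed) if it does not depend on the parameters. -/
def IsKnown {α : Type*} (f : (Fin M.n → ℝ) → α) : Prop := ∀ θ ∈ M.Θ, ∀ θ' ∈ M.Θ, f θ = f θ'

/-- A transfer function is fixed to zero. -/
def IsFixedZero (f : (Fin M.n → ℝ) → RatFunc ℝ) : Prop := ∀ θ ∈ M.Θ, f θ = 0

/-- The matrix `[(G - I)  X]`. -/
noncomputable def structureMatrix (θ : Fin M.n → ℝ) : Matrix W M.Vertex (RatFunc ℝ) :=
  Matrix.fromCols (M.G θ - 1) (M.X θ)

/-- The rank of every submatrix of `[(G - I)  X]` that does not depend on `θ` equals its structural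
rank. -/
def FixedSubmatricesHaveStructuralRank : Prop :=
  ∀ (rows : Finset W) (cols : Finset M.Vertex),
    M.IsKnown (fun θ => (M.structureMatrix θ).submatrix
      (fun i : rows => (i : W)) (fun k : cols => (k : M.Vertex))) →
    ∀ θ ∈ M.Θ,
      ((M.structureMatrix θ).submatrix
        (fun i : rows => (i : W)) (fun k : cols => (k : M.Vertex))).rank =
      structuralRank ((M.structureMatrix θ).submatrix
        (fun i : rows => (i : W)) (fun k : cols => (k : M.Vertex)))

/-- The directed graph of the model set: an edge for every entry of `G` and `X` that is not fixed
to zero. -/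
def Adj : M.Vertex → M.Vertex → Prop
  | Sum.inl i, Sum.inl j => ¬ M.IsFixedZero fun θ => M.G θ j i
  | Sum.inr x, Sum.inl j => ¬ M.IsFixedZero fun θ => M.X θ j x
  | _, Sum.inr _ => False

/-- `b_{X̄ → W̄}`: the maximum number of vertex disjoint paths from a set of external signals to a
set of internal signals. -/
noncomputable def b (Xbar : Set M.Ext) (Wbar : Set W) : ℕ :=
  maxDisjointPaths M.Adj (Sum.inr '' Xbar) (Sum.inl '' Wbar)

/-- `𝒳_j`: the external signals without unknown edge to `w_j`. -/
def excitation (j : W) : Set M.Ext := {x | M.IsKnown fun θ => M.X θ j x}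

/-- `𝒩_j⁻`: the internal in-neighbors of `w_j`, excluding the measured ones that have a known edge
to `w_j`. -/
def inNeighbors (j : W) : Set W :=
  {i | M.Adj (Sum.inl i) (Sum.inl j) ∧ ¬ (i ∈ M.C ∧ M.IsKnown fun θ => M.G θ j i)}

/-- Generic identifiability of `G_{jN}` from `(w_C, r)`: for almost all `θ₀ ∈ Θ`, the modules
`G_{ji}(q, θ₀)`, `i ∈ N`, are determined within the model set by `C T R` and `C Φ Cᵀ`. -/
def GenericallyIdentifiable (j : W) (N : Set W) : Prop :=
  ∀ᵐ θ₀ : Fin M.n → ℝ, θ₀ ∈ M.Θ → ∀ θ₁ ∈ M.Θ,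
    M.CTR θ₀ = M.CTR θ₁ →
    (∀ ω : ℝ, M.measuredSpectrum θ₀ ω = M.measuredSpectrum θ₁ ω) →
    ∀ i ∈ N, M.G θ₀ j i = M.G θ₁ j i

end ModelSet

end DynNet

/-! Restrict the rows of `T X` to the columns `Xbar`; this gives one transfer vector per internal
signal. The equation of `w_j` says that its vector minus the `G_ji`-weighted sum of the others is
the row `X_j` on `Xbar`, which is known. Subtract these equations for `θ₀` and `θ₁`. Measured
vectors agree for both parameters, so the terms of `w_j` and of measured in-neighbors with a known
edge cancel. What remains says that `∑ (G_ji(θ₀) - G_ji(θ₁)) • (vector of i)` over `i ∈ Nstar` lies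
in the sum of the spans, at `θ₀` and at `θ₁`, of the vectors from `(inNeighbors j \ Nstar) ∪ Cbar`.
The second path condition makes both spans equal to the span of the `Cbar` vectors, and the first
makes the `Nstar` vectors independent modulo it; hence all coefficients vanish.

Two facts carry this. The first is that path counts are generic ranks. By an exchange of columns, a
minor of `T X` vanishes iff a minor of `[(G - I) X]` does (`det_exchange_eq_zero_iff`). A nonzero
Leibniz term of the latter is a permutation along edges, and cutting its cycles at the exchanged
vertices gives vertex-disjoint paths. So the rank never exceeds the path count, at any parameter
(`finrank_transferSpan_le_b`). Conversely, closing up a maximal family of paths gives a transversal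
of entries not fixed to zero. Independent parameterization, Hall's theorem and the rank condition on
fixed submatrices turn it into a generically nonzero determinant (`ae_det_submatrix_ne_zero`).

The second is that the measured spectrum determines the noise transfer matrix (`noiseTransfer_eq`).
The quotient of two stable minimum phase factors is unitary on the circle, so reflection in the
circle and Liouville's theorem make it constant. The feedthrough condition then forces this constant
to be the identity. -/

namespace DynNet

/-! ### Generic nonvanishing of polynomials and of determinants with independent entries -/

/-- A nonzero real polynomial in several variables is nonzero almost everywhere. -/
theorem ae_eval_ne_zero {n : ℕ} (p : MvPolynomial (Fin n) ℝ) (hp : p ≠ 0) :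
    ∀ᵐ x : Fin n → ℝ, MvPolynomial.eval x p ≠ 0 := by
  induction n with
  | zero =>
    refine Filter.Eventually.of_forall fun x hx => hp ?_
    obtain ⟨c, rfl⟩ := MvPolynomial.C_surjective (Fin 0) p
    simpa using hx
  | succ n ih =>
    set q := MvPolynomial.finSuccEquiv ℝ n p with hq
    -- Fubini in the first variable: `q` has finitely many roots of the form `C y`, and for every
    -- other `y` the slice is a nonzero polynomial in `n` variables.
    have hq0 : q ≠ 0 := by simpa [hq] using hp
    have hmeas : MeasurableSet {x : Fin (n + 1) → ℝ | MvPolynomial.eval x p = 0} :=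
      (isClosed_eq (MvPolynomial.continuous_eval p) continuous_const).measurableSet
    have e := volume_preserving_piFinSuccAbove (fun _ : Fin (n + 1) => ℝ) 0
    rw [ae_iff]
    simp only [ne_eq, not_not]
    rw [← e.symm.measure_preimage hmeas.nullMeasurableSet]
    rw [Measure.volume_eq_prod, Measure.measure_prod_null (e.symm.measurable hmeas)]
    have hfin : {y : ℝ | q.eval (MvPolynomial.C y) = 0}.Finite := by
      have := (q.roots.toFinset.finite_toSet).preimage
        (f := fun y : ℝ => (MvPolynomial.C y : MvPolynomial (Fin n) ℝ))
        (MvPolynomial.C_injective _ _).injOn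
      refine this.subset fun y hy => ?_
      simpa [hq0] using hy
    have hae : ∀ᵐ y : ℝ, q.eval (MvPolynomial.C y) ≠ 0 := by
      rw [ae_iff]
      simpa using hfin.measure_zero volume
    filter_upwards [hae] with y hy
    have := ih _ hy
    rw [ae_iff] at this
    simp only [ne_eq, not_not] at this
    refine (measure_mono_null (fun s hs => ?_) this)
    simp only [Set.mem_preimage, Set.mem_ofPred_eq] at hs ⊢
    have h1 : (MeasurableEquiv.piFinSuccAbove (fun _ : Fin (n + 1) => ℝ) 0).symm (y, s)
        = Fin.cons y s := by
      ext i
      simp [MeasurableEquiv.piFinSuccAbove]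
    rw [h1, MvPolynomial.eval_eq_eval_mv_eval', ← hq] at hs
    rw [← hs]
    have := Polynomial.hom_eval₂ q (RingHom.id _) (MvPolynomial.eval s) (MvPolynomial.C y)
    simp only [RingHom.comp_id, MvPolynomial.eval_C] at this
    rw [Polynomial.eval_map, ← this]
    rfl

/-- A square matrix with an independently varying family of entries and nonzero diagonal has
generically nonzero determinant, provided its constant submatrices with nonzero diagonal are
invertible. -/
theorem exists_det_ne_zero_of_mixing {P R C F : Type*} [Field F] [Nonempty P]
    (A : P → Matrix R C F)
    (hmix : ∀ (E : Set (R × C)) (p₁ p₂ : P), ∃ p, ∀ i k,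
      ((i, k) ∈ E → A p i k = A p₁ i k) ∧ ((i, k) ∉ E → A p i k = A p₂ i k))
    (hconst : ∀ (n : ℕ) (r : Fin n ↪ R) (c : Fin n ↪ C),
      (∀ i k p p', A p (r i) (c k) = A p' (r i) (c k)) → (∀ i p, A p (r i) (c i) ≠ 0) →
      ∀ p, ((A p).submatrix r c).det ≠ 0) :
    ∀ (n : ℕ) (r : Fin n ↪ R) (c : Fin n ↪ C),
      (∀ i, ∃ p, A p (r i) (c i) ≠ 0) → ∃ p, ((A p).submatrix r c).det ≠ 0 := by
  classical
  intro n
  induction n using Nat.strong_induction_on with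
  | _ n ih =>
  intro r c hd
  -- A fully constant submatrix is covered by `hconst`. Otherwise some entry `(i₀, k₀)` varies, and
  -- Hall's theorem is applied to the complementary minor.
  by_cases hk : ∀ i k p p', A p (r i) (c k) = A p' (r i) (c k)
  · obtain ⟨p⟩ := ‹Nonempty P›
    refine ⟨p, hconst n r c hk (fun i p => ?_) p⟩
    obtain ⟨p', hp'⟩ := hd i
    rwa [hk i i p p']
  push Not at hk
  obtain ⟨i₀, k₀, p₁, p₂, h12⟩ := hk
  obtain ⟨m, rfl⟩ : ∃ m, n = m + 1 := ⟨n - 1, by have := i₀.pos; omega⟩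
  -- the zero pattern of the minor
  let t : Fin m → Finset (Fin m) := fun a => Finset.univ.filter fun b =>
    ∃ p, A p (r (i₀.succAbove a)) (c (k₀.succAbove b)) ≠ 0
  by_cases hall : ∃ f : Fin m → Fin m, Function.Injective f ∧ ∀ a, f a ∈ t a
  · obtain ⟨f, hf, hft⟩ := hall
    let e : Fin m ≃ Fin m := Equiv.ofBijective f (Finite.injective_iff_bijective.1 hf)
    obtain ⟨p, hp⟩ := ih m (Nat.lt_succ_self m) (i₀.succAboveEmb.trans r)
      ((e.toEmbedding.trans k₀.succAboveEmb).trans c) (fun a => by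
        have := hft a
        simp only [t, Finset.mem_filter, Finset.mem_univ, true_and] at this
        exact this)
    have hminor : (((A p).submatrix r c).submatrix i₀.succAbove k₀.succAbove).det ≠ 0 := by
      intro h0
      apply hp
      have : (A p).submatrix (i₀.succAboveEmb.trans r)
          ((e.toEmbedding.trans k₀.succAboveEmb).trans c) =
          (((A p).submatrix r c).submatrix i₀.succAbove k₀.succAbove).submatrix id e := by
        ext a b; rfl
      rw [this, Matrix.det_permute', h0, mul_zero]
    by_cases hp0 : ((A p).submatrix r c).det = 0
    -- Change only the entry `(i₀, k₀)`: the determinant is affine in it, with the nonzero minor as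
    -- slope up to sign.
    · obtain ⟨p₃, hp₃⟩ : ∃ p₃, A p₃ (r i₀) (c k₀) ≠ A p (r i₀) (c k₀) := by
        by_contra! h
        exact h12 ((h p₁).trans (h p₂).symm)
      obtain ⟨p', hp'⟩ := hmix {(r i₀, c k₀)} p₃ p
      refine ⟨p', ?_⟩
      intro hdet
      rw [Matrix.det_succ_row _ i₀, Fin.sum_univ_succAbove _ k₀] at hp0 hdet
      have hsub : ∀ b, ((A p').submatrix r c).submatrix i₀.succAbove (Fin.succAbove b) =
          ((A p).submatrix r c).submatrix i₀.succAbove (Fin.succAbove b) := by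
        intro b
        ext x y
        refine (hp' _ _).2 ?_
        simp only [Set.mem_singleton_iff, Prod.mk.injEq, EmbeddingLike.apply_eq_iff_eq, not_and]
        intro h
        exact absurd h (Fin.succAbove_ne _ _)
      have hrow : ∀ b, ((A p').submatrix r c) i₀ (k₀.succAbove b) =
          ((A p).submatrix r c) i₀ (k₀.succAbove b) := by
        intro b
        refine (hp' _ _).2 ?_
        simp only [Set.mem_singleton_iff, Prod.mk.injEq, EmbeddingLike.apply_eq_iff_eq, not_and]
        intro _ h
        exact absurd h (Fin.succAbove_ne _ _)
      have h00 : ((A p').submatrix r c) i₀ k₀ = A p₃ (r i₀) (c k₀) := (hp' _ _).1 rfl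
      simp only [hsub, hrow, h00] at hdet
      rw [← hp0, add_left_inj] at hdet
      refine hp₃ ?_
      have hs : ((-1 : F) ^ ((i₀ : ℕ) + (k₀ : ℕ))) ≠ 0 := by simp
      exact mul_left_cancel₀ hs (mul_right_cancel₀ hminor hdet)
    · exact ⟨p, hp0⟩
  -- Hall's condition fails for the minor: some rows `s` meet fewer than `|s|` columns outside `k₀`.
  -- The matrix is then block triangular with two smaller diagonal blocks.
  · rw [← Finset.all_card_le_biUnion_card_iff_exists_injective] at hall
    push Not at hall
    obtain ⟨s, hs⟩ := hall
    -- rows `S`, whose nonzero columns are exactly `S`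
    let S : Finset (Fin (m + 1)) := s.map i₀.succAboveEmb
    let N : Finset (Fin (m + 1)) := insert k₀ ((s.biUnion t).map k₀.succAboveEmb)
    have hN : ∀ a ∈ S, ∀ b, (∃ p, A p (r a) (c b) ≠ 0) → b ∈ N := by
      intro a ha b hb
      obtain ⟨a', ha', rfl⟩ := Finset.mem_map.1 ha
      rcases Fin.eq_self_or_eq_succAbove k₀ b with rfl | ⟨b', rfl⟩
      · exact Finset.mem_insert_self _ _
      · refine Finset.mem_insert_of_mem (Finset.mem_map_of_mem k₀.succAboveEmb
          (Finset.mem_biUnion.2 ⟨a', ha', ?_⟩))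
        simpa [t] using hb
    -- The diagonal transversal gives `S ⊆ N` and the Hall defect gives `|N| ≤ |S|`. Since `k₀ ∈ S`
    -- and `i₀ ∉ S`, both blocks are proper.
    have hSN : S ⊆ N := fun a ha => hN a ha a (hd a)
    have hcard : N.card ≤ S.card := by
      refine (Finset.card_insert_le _ _).trans ?_
      simp only [Finset.card_map, S]
      omega
    have hSeq : S = N := Finset.eq_of_subset_of_card_le hSN hcard
    have hi₀ : i₀ ∉ S := by simp [S, Fin.succAbove_ne]
    have hk₀ : k₀ ∈ S := by rw [hSeq]; exact Finset.mem_insert_self _ _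
    have hzero : ∀ p, ∀ a ∈ S, ∀ b ∉ S, A p (r a) (c b) = 0 := by
      intro p a ha b hb
      by_contra h
      exact hb (hSeq ▸ hN a ha b ⟨p, h⟩)
    have block : ∀ Q : Fin (m + 1) → Prop, (∃ a, ¬ Q a) →
        ∃ p, (((A p).submatrix r c).toSquareBlockProp Q).det ≠ 0 := by
      intro Q ⟨a, ha⟩
      have hlt : Fintype.card {a // Q a} < m + 1 := by
        simpa using Fintype.card_subtype_lt (p := Q) ha
      let e := (Fintype.equivFin {a // Q a}).symm
      obtain ⟨p, hp⟩ := ih _ hlt ((e.toEmbedding.trans (Function.Embedding.subtype _)).trans r)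
        ((e.toEmbedding.trans (Function.Embedding.subtype _)).trans c) (fun a => hd _)
      refine ⟨p, ?_⟩
      rw [← Matrix.det_submatrix_equiv_self e]
      exact hp
    obtain ⟨q₁, hq₁⟩ := block (fun a => a ∈ S) ⟨i₀, hi₀⟩
    obtain ⟨q₂, hq₂⟩ := block (fun a => ¬ a ∈ S) ⟨k₀, by simpa using hk₀⟩
    -- The two blocks lie in disjoint sets of rows, so a single parameter can realize both nonzero
    -- determinants.
    obtain ⟨p, hp⟩ := hmix {e | ∃ a ∈ S, e.1 = r a} q₁ q₂
    refine ⟨p, ?_⟩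
    rw [Matrix.twoBlockTriangular_det' ((A p).submatrix r c) (fun a => a ∈ S) (fun a ha b hb => hzero p a ha b hb)]
    refine mul_ne_zero ?_ ?_
    · convert hq₁ using 2
      ext a b
      exact (hp _ _).1 ⟨a, a.2, rfl⟩
    · convert hq₂ using 2
      ext a b
      refine (hp _ _).2 ?_
      rintro ⟨x, hx, hxe⟩
      exact a.2 (by rwa [r.injective hxe])

/-- A zero pattern with a nonzero transversal has full structural rank. -/
theorem structuralRank_eq_of_equiv {F ι κ : Type*} [Field F] [Infinite F] [Fintype ι] [Fintype κ]
    {n : ℕ} (A : Matrix ι κ F) (e : Fin n ≃ ι) (e' : Fin n ≃ κ) (hA : ∀ a, A (e a) (e' a) ≠ 0) :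
    structuralRank A = n := by
  classical
  -- The witness is `t • 1 - N`, with `N` the off-diagonal pattern. It has the required pattern when
  -- `t ≠ 0` and is invertible when `t` is not an eigenvalue of `N`; the factor `X` next to the
  -- characteristic polynomial excludes `t = 0`.
  let N : Matrix (Fin n) (Fin n) F :=
    Matrix.of fun i k => if i = k ∨ A (e i) (e' k) = 0 then 0 else 1
  obtain ⟨t, ht⟩ := Infinite.exists_notMem_finset ((N.charpoly * Polynomial.X).roots.toFinset)
  have hne : N.charpoly * Polynomial.X ≠ 0 :=
    mul_ne_zero N.charpoly_monic.ne_zero Polynomial.X_ne_zero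
  simp only [Multiset.mem_toFinset, Polynomial.mem_roots hne, Polynomial.IsRoot,
    Polynomial.eval_mul, Polynomial.eval_X, mul_eq_zero, not_or] at ht
  obtain ⟨ht1, ht0⟩ := ht
  rw [Matrix.eval_charpoly] at ht1
  have hcard : Fintype.card κ = n := by simpa using (Fintype.card_congr e').symm
  have hmem : n ∈ {r | ∃ B : Matrix ι κ F, (∀ i k, B i k = 0 ↔ A i k = 0) ∧ B.rank = r} := by
    refine ⟨Matrix.reindex e e' (Matrix.scalar (Fin n) t - N), fun i k => ?_, ?_⟩
    · obtain ⟨i, rfl⟩ := e.surjective i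
      obtain ⟨k, rfl⟩ := e'.surjective k
      by_cases hik : i = k
      · subst hik
        simp [N, ht0, hA]
      · by_cases h0 : A (e i) (e' k) = 0 <;> simp [N, hik, h0]
    · rw [Matrix.rank_reindex, Matrix.rank_of_det_ne_zero ht1, Fintype.card_fin]
  refine le_antisymm (csSup_le ⟨_, hmem⟩ ?_) (le_csSup ⟨n, ?_⟩ hmem)
  · rintro r ⟨B, -, rfl⟩
    exact B.rank_le_card_width.trans hcard.le
  · rintro r ⟨B, -, rfl⟩
    exact B.rank_le_card_width.trans hcard.le

end DynNet

/-! ### Vertex-disjoint paths and permutations -/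

namespace DynNet

section Paths

variable {W E : Type*} {Adj : W ⊕ E → W ⊕ E → Prop}

/-- Families of vertex disjoint paths in a finite graph have bounded size. -/
theorem bddAbove_card_disjointPaths {V : Type*} [Finite V] (Adj : V → V → Prop) (V₁ V₂ : Set V) :
    BddAbove {k | ∃ P : Fin k → List V,
      (∀ a, IsPathFromTo Adj V₁ V₂ (P a)) ∧ ∀ a b, a ≠ b → (P a).Disjoint (P b)} := by
  refine ⟨Nat.card V, ?_⟩
  rintro k ⟨P, hP, hd⟩
  choose h hh hh' using fun a => (hP a).2.2.1
  have hinj : Function.Injective h := by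
    intro a b hab
    by_contra hne
    exact hd a b hne (List.mem_of_head? (hh' a)) (hab ▸ List.mem_of_head? (hh' b))
  simpa using Nat.card_le_card_of_injective h hinj

/-- No edge enters an external signal, so a path can meet one only at its first vertex. -/
theorem eq_map_inl_of_isChain (hAdj : ∀ v x, ¬ Adj v (Sum.inr x)) :
    ∀ (v : W ⊕ E) (l : List (W ⊕ E)), (v :: l).IsChain Adj → ∃ l' : List W, l = l'.map Sum.inl := by
  intro v l
  induction l generalizing v with
  | nil => exact fun _ => ⟨[], rfl⟩
  | cons u l ih =>
    intro h
    rw [List.isChain_cons_cons] at h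
    obtain ⟨l', rfl⟩ := ih u h.2
    rcases u with u | u
    · exact ⟨u :: l', rfl⟩
    · exact absurd h.1 (hAdj _ _)

/-- Vertex disjoint paths from `X` to `Y` yield a permutation whose cycles close up the paths. -/
theorem exists_perm_of_disjointPaths [Finite W] (hAdj : ∀ v x, ¬ Adj v (Sum.inr x))
    (X : Set E) (Y : Set W) {k : ℕ} (P : Fin k → List (W ⊕ E))
    (hP : ∀ a, IsPathFromTo Adj (Sum.inr '' X) (Sum.inl '' Y) (P a))
    (hd : ∀ a b, a ≠ b → (P a).Disjoint (P b)) :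
    ∃ (w : Fin k ↪ W) (x : Fin k ↪ E) (σ : Equiv.Perm W), (∀ a, w a ∈ Y) ∧ (∀ a, x a ∈ X) ∧
      (∀ a, Adj (Sum.inr (x a)) (Sum.inl (σ (w a)))) ∧
      ∀ i, i ∉ Set.range w → σ i = i ∨ Adj (Sum.inl i) (Sum.inl (σ i)) := by
  classical
  have hform : ∀ a, ∃ x ∈ X, ∃ (u : W) (l : List W), (u :: l).getLast (by simp) ∈ Y ∧
      P a = Sum.inr x :: (u :: l).map Sum.inl := by
    intro a
    obtain ⟨-, hc, ⟨_, ⟨x, hx, rfl⟩, hh⟩, ⟨_, ⟨y, hy, rfl⟩, hl⟩⟩ := hP a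
    obtain ⟨t, ht⟩ : ∃ t, P a = Sum.inr x :: t := List.head?_eq_some_iff.1 hh
    rw [ht] at hc hl
    obtain ⟨l', rfl⟩ := eq_map_inl_of_isChain hAdj _ _ hc
    rcases l' with _ | ⟨u, l⟩
    · simp at hl
    · refine ⟨x, hx, u, l, ?_, ht⟩
      have h2 : (Sum.inr x :: List.map Sum.inl (u :: l) : List (W ⊕ E)).getLast? =
          some (Sum.inl ((u :: l).getLast (by simp))) := by
        rw [List.getLast?_cons, List.getLast?_map, List.getLast?_eq_some_getLast (List.cons_ne_nil _ _)]
        rfl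
      rw [h2] at hl
      simp only [Option.some.injEq, Sum.inl.injEq] at hl
      rwa [hl]
  choose x hx u l hl hPa using hform
  let L : Fin k → List W := fun a => u a :: l a
  have hLd : ∀ a b i, i ∈ L a → i ∈ L b → a = b := by
    intro a b i ha hb
    by_contra hne
    refine @hd a b hne (Sum.inl i) ?_ ?_
    · rw [hPa]; exact List.mem_cons_of_mem _ (List.mem_map_of_mem ha)
    · rw [hPa]; exact List.mem_cons_of_mem _ (List.mem_map_of_mem hb)
  have hLn : ∀ a, (L a).Nodup := by
    intro a
    have := (hP a).1
    rw [hPa] at this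
    exact (List.nodup_cons.1 this).2.of_map _
  -- Turn the internal part of each path into a cycle, last vertex back to first, and fix all other
  -- vertices. The image of an endpoint is thus the vertex entered by the edge from the external
  -- signal.
  let f : W → W := fun i => if h : ∃ a, i ∈ L a then (L h.choose).formPerm i else i
  have hf : ∀ a i, i ∈ L a → f i = (L a).formPerm i := by
    intro a i hi
    have h : ∃ a, i ∈ L a := ⟨a, hi⟩
    simp only [f, dif_pos h]
    rw [hLd _ _ i h.choose_spec hi]
  have hf' : ∀ i, (¬ ∃ a, i ∈ L a) → f i = i := fun i hi => by simp only [f, dif_neg hi]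
  have hfinj : Function.Injective f := by
    intro i i' hii
    by_cases h : ∃ a, i ∈ L a
    · obtain ⟨a, ha⟩ := h
      rw [hf a i ha] at hii
      have h1 : (L a).formPerm i ∈ L a := List.formPerm_apply_mem_of_mem ha
      by_cases h' : ∃ a, i' ∈ L a
      · obtain ⟨b, hb⟩ := h'
        rw [hf b i' hb] at hii
        have h2 : (L b).formPerm i' ∈ L b := List.formPerm_apply_mem_of_mem hb
        obtain rfl := hLd a b _ h1 (hii ▸ h2)
        exact (L a).formPerm.injective hii
      · rw [hf' i' h'] at hii
        exact absurd ⟨a, hii ▸ h1⟩ h'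
    · rw [hf' i h] at hii
      by_cases h' : ∃ a, i' ∈ L a
      · obtain ⟨b, hb⟩ := h'
        rw [hf b i' hb] at hii
        exact absurd ⟨b, hii ▸ List.formPerm_apply_mem_of_mem hb⟩ h
      · rwa [hf' i' h'] at hii
  let σ : Equiv.Perm W := Equiv.ofBijective f (Finite.injective_iff_bijective.1 hfinj)
  have hw : ∀ a, (L a).getLast (by simp [L]) ∈ L a := fun a => List.getLast_mem _
  refine ⟨⟨fun a => (L a).getLast (by simp [L]), fun a b hab => hLd a b _ (hw a) ?_⟩,
    ⟨x, fun a b hab => ?_⟩, σ, hl, hx, fun a => ?_, fun i hi => ?_⟩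
  · simp only at hab
    rw [hab]; exact hw b
  · by_contra hne
    refine @hd a b hne (Sum.inr (x a)) ?_ ?_
    · rw [hPa]; exact List.mem_cons_self
    · rw [hPa, hab]; exact List.mem_cons_self
  · have h1 : σ ((L a).getLast (by simp [L])) = u a := by
      change f _ = _
      rw [hf a _ (hw a)]
      exact List.formPerm_apply_getLast (u a) (l a)
    have hc := (hP a).2.1
    rw [hPa, List.map_cons, List.isChain_cons_cons] at hc
    change Adj (Sum.inr (x a)) (Sum.inl (σ ((L a).getLast (by simp [L]))))
    rw [h1]
    exact hc.1
  · by_cases h : ∃ a, i ∈ L a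
    · obtain ⟨a, ha⟩ := h
      right
      have h1 : σ i = (L a).formPerm i := hf a i ha
      obtain ⟨n, hn, rfl⟩ := List.getElem_of_mem ha
      have hn' : n + 1 < (L a).length := by
        by_contra hcon
        refine hi ⟨a, ?_⟩
        change (L a).getLast _ = _
        rw [List.getLast_eq_getElem]
        congr 1
        omega
      rw [h1, List.formPerm_apply_lt_getElem _ (hLn a) n hn']
      have hc := (hP a).2.1
      rw [hPa] at hc
      have hc := List.isChain_iff_getElem.1 (List.isChain_cons.1 hc).2 n (by simpa [L] using hn')
      rw [List.getElem_map, List.getElem_map] at hc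
      exact hc
    · left
      exact hf' i h

/-- A permutation following edges outside the range of `w` decomposes into vertex disjoint paths. -/
theorem exists_disjointPaths_of_perm [Finite W] (X : Set E) (Y : Set W) {k : ℕ}
    (w : Fin k ↪ W) (x : Fin k ↪ E) (σ : Equiv.Perm W) (hw : ∀ a, w a ∈ Y) (hx : ∀ a, x a ∈ X)
    (hσx : ∀ a, Adj (Sum.inr (x a)) (Sum.inl (σ (w a))))
    (hσ : ∀ i, i ∉ Set.range w → σ i = i ∨ Adj (Sum.inl i) (Sum.inl (σ i))) :
    ∃ P : Fin k → List (W ⊕ E),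
      (∀ a, IsPathFromTo Adj (Sum.inr '' X) (Sum.inl '' Y) (P a)) ∧
      ∀ a b, a ≠ b → (P a).Disjoint (P b) := by
  classical
  -- The path of `a` is `x a`, `σ (w a)`, `σ² (w a)`, and so on until the orbit first returns to the
  -- range of `w`, possibly at `w b` with `b ≠ a`.
  have hret : ∀ a, ∃ m, (σ ^ (m + 1)) (w a) ∈ Set.range w := by
    intro a
    refine ⟨orderOf σ - 1, a, ?_⟩
    rw [Nat.sub_add_cancel (orderOf_pos σ), pow_orderOf_eq_one]
    rfl
  let m : Fin k → ℕ := fun a => Nat.find (hret a)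
  have hm : ∀ a, (σ ^ (m a + 1)) (w a) ∈ Set.range w := fun a => Nat.find_spec (hret a)
  have hmin : ∀ a t, t < m a → (σ ^ (t + 1)) (w a) ∉ Set.range w :=
    fun a t ht => Nat.find_min (hret a) ht
  -- Disjointness and absence of repetitions together: cancelling `σ ^ (s + 1)` from a coincidence
  -- with `s < t` puts an earlier orbit point of `w b` in the range of `w`, against minimality.
  have key : ∀ a b s t, s ≤ m a → t ≤ m b → (σ ^ (s + 1)) (w a) = (σ ^ (t + 1)) (w b) →
      a = b ∧ s = t := by
    have aux : ∀ a b s t, s ≤ t → t ≤ m b → (σ ^ (s + 1)) (w a) = (σ ^ (t + 1)) (w b) →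
        a = b ∧ s = t := by
      intro a b s t hst ht h
      have h1 : t + 1 = (s + 1) + (t - s) := by omega
      rw [h1, pow_add _ (s + 1) (t - s), Equiv.Perm.mul_apply, EmbeddingLike.apply_eq_iff_eq] at h
      rcases Nat.eq_or_lt_of_le hst with rfl | hlt
      · simp only [Nat.sub_self, pow_zero, Equiv.Perm.one_apply] at h
        exact ⟨w.injective h, rfl⟩
      · exfalso
        refine hmin b (t - s - 1) (by omega) ⟨a, ?_⟩
        rw [h]
        congr 2
        omega
    intro a b s t hs ht h
    rcases le_total s t with hst | hst
    · exact aux a b s t hst ht h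
    · obtain ⟨h1, h2⟩ := aux b a t s hst hs h.symm
      exact ⟨h1.symm, h2.symm⟩
  let q : Fin k → List W := fun a => (List.range (m a + 1)).map fun t => (σ ^ (t + 1)) (w a)
  have hq : ∀ a i, i ∈ q a ↔ ∃ t ≤ m a, (σ ^ (t + 1)) (w a) = i := by
    intro a i
    simp [q]
  refine ⟨fun a => Sum.inr (x a) :: (q a).map Sum.inl, fun a => ⟨?_, ?_, ?_, ?_⟩, ?_⟩
  · rw [List.nodup_cons]
    refine ⟨by simp, List.Nodup.map Sum.inl_injective ?_⟩
    refine List.Nodup.map_on (fun s hs t ht h => ?_) List.nodup_range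
    simp only [List.mem_range, Nat.lt_succ_iff] at hs ht
    exact (key a a s t hs ht h).2
  · rw [List.isChain_iff_getElem]
    intro t ht
    simp only [List.length_cons, List.length_map, List.length_range, q] at ht
    rcases t with _ | t
    · simpa [q] using hσx a
    · have ht' : t < m a := by omega
      simp only [List.getElem_cons_succ, List.getElem_map, List.getElem_range, q]
      have h2 : (σ ^ (t + 1 + 1)) (w a) = σ ((σ ^ (t + 1)) (w a)) := by
        rw [pow_succ', Equiv.Perm.mul_apply]
      rw [h2]
      -- A fixed point cannot occur here: it would repeat a vertex of the path, contradicting `key`.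
      rcases hσ _ (hmin a t ht') with h | h
      · rw [← h2] at h
        have := (key a a (t + 1) t (by omega) (by omega) h).2
        omega
      · exact h
  · exact ⟨_, ⟨x a, hx a, rfl⟩, rfl⟩
  · obtain ⟨b, hb⟩ := hm a
    refine ⟨_, ⟨w b, hw b, rfl⟩, ?_⟩
    rw [hb]
    simp [q, List.range_succ, List.getLast?_cons]
  · intro a b hab v hva hvb
    rcases v with i | y
    · simp only [List.mem_cons, reduceCtorEq, List.mem_map, Sum.inl.injEq, exists_eq_right,
        false_or] at hva hvb
      obtain ⟨s, hs, rfl⟩ := (hq a i).1 hva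
      obtain ⟨t, ht, h⟩ := (hq b _).1 hvb
      exact hab (key a b s t hs ht h.symm).1
    · simp only [List.mem_cons, Sum.inr.injEq, List.mem_map, reduceCtorEq, and_false, exists_false,
        or_false] at hva hvb
      exact hab (x.injective (hva.symm.trans hvb))

end Paths

end DynNet

/-! ### Minors of `T X` as exchanged minors of `[(G - I) X]` -/

namespace DynNet

/-- The identity matrix with the columns in the range of `w` replaced by those of `B` has the
determinant of the corresponding submatrix of `B`. -/
theorem det_replace_columns {W E F : Type*} [Field F] [Fintype W] [DecidableEq W]
    (B : Matrix W E F) {k : ℕ} (w : Fin k ↪ W) (x : Fin k ↪ E) (c : W → W ⊕ E)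
    (hcw : ∀ a, c (w a) = Sum.inr (x a)) (hc : ∀ i, i ∉ Set.range w → c i = Sum.inl i) :
    ((Matrix.fromCols (1 : Matrix W W F) B).submatrix id c).det = (B.submatrix w x).det := by
  classical
  obtain ⟨p, hp⟩ : ∃ p : W → Prop, ∀ i, p i ↔ i ∈ Set.range w := ⟨_, fun _ => Iff.rfl⟩
  rw [Matrix.twoBlockTriangular_det' _ p]
  · have h2 : (((Matrix.fromCols (1 : Matrix W W F) B).submatrix id c).toSquareBlockProp
        (fun i => ¬ p i)) = 1 := by
      ext ⟨i, hi⟩ ⟨k, hk⟩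
      simp [Matrix.toSquareBlockProp, hc k ((hp k).not.1 hk), Matrix.one_apply]
    let e : Fin k ≃ {i // p i} :=
      (Equiv.ofInjective w w.injective).trans (Equiv.subtypeEquivRight fun i => (hp i).symm)
    rw [h2, Matrix.det_one, mul_one, ← Matrix.det_submatrix_equiv_self e]
    congr 1
    ext a b
    simp [Matrix.toSquareBlockProp, hcw, e]
  · intro i hi k hk
    have hik : i ≠ k := by rintro rfl; exact hk hi
    simp [hc k ((hp k).not.1 hk), hik]

namespace ModelSet

section

variable {W K : Type*} [DecidableEq W] (M : ModelSet W K)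

theorem not_adj_inr (v : M.Vertex) (x : M.Ext) : ¬ M.Adj v (Sum.inr x) := by
  rcases v with v | v <;> exact id

/-- The columns of `[(G - I)  X]` that replace `w a` by the external signal `x a`. -/
noncomputable def exchange {k : ℕ} (w : Fin k ↪ W) (x : Fin k ↪ M.Ext) : W → M.Vertex :=
  fun i => open Classical in if h : ∃ a, w a = i then Sum.inr (x h.choose) else Sum.inl i

theorem exchange_apply {k : ℕ} (w : Fin k ↪ W) (x : Fin k ↪ M.Ext) (a : Fin k) :
    M.exchange w x (w a) = Sum.inr (x a) := by
  have h : ∃ b, w b = w a := ⟨a, rfl⟩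
  rw [exchange, dif_pos h, w.injective h.choose_spec]

theorem exchange_of_notMem {k : ℕ} (w : Fin k ↪ W) (x : Fin k ↪ M.Ext) {i : W}
    (hi : i ∉ Set.range w) : M.exchange w x i = Sum.inl i := dif_neg hi

theorem exchange_injective {k : ℕ} (w : Fin k ↪ W) (x : Fin k ↪ M.Ext) :
    Function.Injective (M.exchange w x) := by
  intro i i' h
  by_cases hi : i ∈ Set.range w <;> by_cases hi' : i' ∈ Set.range w
  · obtain ⟨a, rfl⟩ := hi
    obtain ⟨b, rfl⟩ := hi'
    rw [exchange_apply, exchange_apply] at h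
    rw [x.injective (Sum.inr_injective h)]
  · obtain ⟨a, rfl⟩ := hi
    rw [exchange_apply, exchange_of_notMem _ _ _ hi'] at h
    cases h
  · obtain ⟨a, rfl⟩ := hi'
    rw [exchange_apply, exchange_of_notMem _ _ _ hi] at h
    cases h
  · rw [exchange_of_notMem _ _ _ hi, exchange_of_notMem _ _ _ hi'] at h
    exact Sum.inl_injective h

end

variable {W K : Type*} [Fintype W] [DecidableEq W] (M : ModelSet W K)

/-- Multiplication by the invertible matrix `-T` turns `[(G - I) X]` into `[1 -T X]`. The
determinant on the exchanged columns is then a minor of `-T X`, because the remaining columns are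
unit vectors. This trades the entries of `T X`, which mix all parameters, for entries that are
single edges. -/
theorem det_exchange_eq_zero_iff {θ : Fin M.n → ℝ} (hdet : (1 - M.G θ).det ≠ 0) {k : ℕ}
    (w : Fin k ↪ W) (x : Fin k ↪ M.Ext) :
    ((M.structureMatrix θ).submatrix id (M.exchange w x)).det = 0 ↔
      ((M.T θ * M.X θ).submatrix w x).det = 0 := by
  have hT : (M.T θ).det ≠ 0 := by
    rw [T, Matrix.det_nonsing_inv, Ring.inverse_eq_inv']
    exact inv_ne_zero hdet
  have hTG : M.T θ * (M.G θ - 1) = -1 := by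
    rw [← neg_sub, Matrix.mul_neg, T, Matrix.nonsing_inv_mul _ (Ne.isUnit hdet)]
  have h1 : (-M.T θ) * (M.structureMatrix θ).submatrix id (M.exchange w x) =
      (Matrix.fromCols 1 (-(M.T θ * M.X θ))).submatrix id (M.exchange w x) := by
    have : (-M.T θ) * (M.structureMatrix θ) = Matrix.fromCols 1 (-(M.T θ * M.X θ)) := by
      rw [structureMatrix, Matrix.mul_fromCols, Matrix.neg_mul, hTG, neg_neg, Matrix.neg_mul]
    rw [← this]
    rfl
  have h2 := congrArg Matrix.det h1
  rw [Matrix.det_mul, det_replace_columns _ w x _ (M.exchange_apply w x)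
    (fun i hi => M.exchange_of_notMem w x hi)] at h2
  have h3 : (-(M.T θ * M.X θ)).submatrix w x = -((M.T θ * M.X θ).submatrix w x) := rfl
  have hT' : (-M.T θ).det ≠ 0 := by
    rw [Matrix.det_neg]
    exact mul_ne_zero (by simp) hT
  rw [h3, Matrix.det_neg ((M.T θ * M.X θ).submatrix w x)] at h2
  constructor
  · intro h
    rw [h, mul_zero] at h2
    rcases mul_eq_zero.1 h2.symm with h4 | h4
    · exact absurd h4 (by simp)
    · exact h4
  · intro h
    rw [h, mul_zero] at h2
    exact (mul_eq_zero.1 h2).resolve_left hT'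

/-- The maximum number of vertex disjoint paths is attained. -/
theorem exists_perm_of_b (Xbar : Set M.Ext) (Wbar : Set W) :
    ∃ (w : Fin (M.b Xbar Wbar) ↪ W) (x : Fin (M.b Xbar Wbar) ↪ M.Ext) (σ : Equiv.Perm W),
      (∀ a, w a ∈ Wbar) ∧ (∀ a, x a ∈ Xbar) ∧
      (∀ a, M.Adj (Sum.inr (x a)) (Sum.inl (σ (w a)))) ∧
      ∀ i, i ∉ Set.range w → σ i = i ∨ M.Adj (Sum.inl i) (Sum.inl (σ i)) := by
  have : Finite K := Finite.of_injective M.exc M.exc.injective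
  have hmem := Nat.sSup_mem (s := {k | ∃ P : Fin k → List M.Vertex,
      (∀ a, IsPathFromTo M.Adj (Sum.inr '' Xbar) (Sum.inl '' Wbar) (P a)) ∧
        ∀ a b, a ≠ b → (P a).Disjoint (P b)})
    ⟨0, fun a => a.elim0, fun a => a.elim0, fun a => a.elim0⟩
    (bddAbove_card_disjointPaths M.Adj _ _)
  obtain ⟨P, hP, hd⟩ := hmem
  exact exists_perm_of_disjointPaths M.not_adj_inr Xbar Wbar P hP hd

/-- A nonsingular submatrix of `T X` yields vertex disjoint paths. -/
theorem le_b_of_det_ne_zero {θ : Fin M.n → ℝ} (hθ : θ ∈ M.Θ) (hdet : (1 - M.G θ).det ≠ 0) {k : ℕ}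
    (w : Fin k ↪ W) (x : Fin k ↪ M.Ext) (Xbar : Set M.Ext) (Wbar : Set W)
    (hw : ∀ a, w a ∈ Wbar) (hx : ∀ a, x a ∈ Xbar)
    (h : ((M.T θ * M.X θ).submatrix w x).det ≠ 0) : k ≤ M.b Xbar Wbar := by
  have : Finite K := Finite.of_injective M.exc M.exc.injective
  rw [ne_eq, ← M.det_exchange_eq_zero_iff hdet, Matrix.det_apply] at h
  -- A nonzero Leibniz term is a permutation all of whose entries are nonzero, hence edges of the
  -- graph or diagonal entries of `G - I`.
  obtain ⟨σ, -, hσ⟩ := Finset.exists_ne_zero_of_sum_ne_zero h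
  have hσ' : ∀ i, M.structureMatrix θ (σ i) (M.exchange w x i) ≠ 0 := by
    intro i h0
    refine hσ ?_
    rw [Finset.prod_eq_zero (Finset.mem_univ i) h0, smul_zero]
  refine le_csSup (bddAbove_card_disjointPaths M.Adj _ _)
    (exists_disjointPaths_of_perm Xbar Wbar w x σ hw hx (fun a => ?_) (fun i hi => ?_))
  · intro h0
    have := hσ' (w a)
    rw [exchange_apply] at this
    exact this (h0 θ hθ)
  · by_cases hi' : σ i = i
    · exact Or.inl hi'
    · right
      intro h0
      have := hσ' i
      rw [M.exchange_of_notMem w x hi] at this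
      refine this ?_
      simp [structureMatrix, hi', h0 θ hθ]

end ModelSet
end DynNet

/-! ### Rational dependence on the parameters and generic rank -/

namespace DynNet

/-- The functions that are quotients of polynomials in `z` with coefficients polynomial in the
parameters, with denominators that do not vanish on `D`. -/
def rationalSubring {n : ℕ} (D : Set (Fin n → ℝ)) : Subring ((Fin n → ℝ) → RatFunc ℝ) where
  carrier := {f | ∃ a b : Polynomial (MvPolynomial (Fin n) ℝ), ∀ θ ∈ D,
    b.map (MvPolynomial.eval θ) ≠ 0 ∧
      f θ = algebraMap (Polynomial ℝ) (RatFunc ℝ) (a.map (MvPolynomial.eval θ)) /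
        algebraMap (Polynomial ℝ) (RatFunc ℝ) (b.map (MvPolynomial.eval θ))}
  zero_mem' := ⟨0, 1, fun θ _ => by simp⟩
  one_mem' := ⟨1, 1, fun θ _ => by simp⟩
  add_mem' := by
    rintro f g ⟨a, b, hf⟩ ⟨c, d, hg⟩
    refine ⟨a * d + b * c, b * d, fun θ hθ => ?_⟩
    obtain ⟨hb, hf⟩ := hf θ hθ
    obtain ⟨hd, hg⟩ := hg θ hθ
    have hb' := RatFunc.algebraMap_ne_zero hb
    have hd' := RatFunc.algebraMap_ne_zero hd
    refine ⟨by simpa using ⟨hb, hd⟩, ?_⟩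
    rw [Pi.add_apply, hf, hg, div_add_div _ _ hb' hd']
    simp
  mul_mem' := by
    rintro f g ⟨a, b, hf⟩ ⟨c, d, hg⟩
    refine ⟨a * c, b * d, fun θ hθ => ?_⟩
    obtain ⟨hb, hf⟩ := hf θ hθ
    obtain ⟨hd, hg⟩ := hg θ hθ
    refine ⟨by simpa using ⟨hb, hd⟩, ?_⟩
    rw [Pi.mul_apply, hf, hg, div_mul_div_comm]
    simp
  neg_mem' := by
    rintro f ⟨a, b, hf⟩
    refine ⟨-a, b, fun θ hθ => ?_⟩
    obtain ⟨hb, hf⟩ := hf θ hθ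
    refine ⟨hb, ?_⟩
    rw [Pi.neg_apply, hf, Polynomial.map_neg, map_neg, neg_div]

/-- A rational function of the parameters that is nonzero somewhere is nonzero almost everywhere. -/
theorem ae_ne_zero_of_mem_rationalSubring {n : ℕ} {D : Set (Fin n → ℝ)}
    {f : (Fin n → ℝ) → RatFunc ℝ} (hf : f ∈ rationalSubring D) {θ₀ : Fin n → ℝ} (hθ₀ : θ₀ ∈ D)
    (h₀ : f θ₀ ≠ 0) : ∀ᵐ θ, θ ∈ D → f θ ≠ 0 := by
  obtain ⟨a, b, hab⟩ := hf
  have h1 : a.map (MvPolynomial.eval θ₀) ≠ 0 := by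
    intro h
    apply h₀
    rw [(hab θ₀ hθ₀).2, h, map_zero, zero_div]
  -- One coefficient of the numerator in `z` is a polynomial in the parameters that is nonzero at
  -- `θ₀`; off its null zero set the function is nonzero.
  obtain ⟨d, hd⟩ : ∃ d, (a.map (MvPolynomial.eval θ₀)).coeff d ≠ 0 := by
    by_contra! h
    exact h1 (Polynomial.ext h)
  rw [Polynomial.coeff_map] at hd
  have hd0 : a.coeff d ≠ 0 := by
    rintro h
    rw [h, map_zero] at hd
    exact hd rfl
  filter_upwards [ae_eval_ne_zero _ hd0] with θ hθ hθD
  rw [(hab θ hθD).2]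
  refine div_ne_zero (RatFunc.algebraMap_ne_zero ?_) (RatFunc.algebraMap_ne_zero (hab θ hθD).1)
  intro h
  apply hθ
  rw [← Polynomial.coeff_map, h, Polynomial.coeff_zero]

theorem det_mem_rationalSubring {n : ℕ} {D : Set (Fin n → ℝ)} {ι : Type*} [Fintype ι]
    [DecidableEq ι] {A : (Fin n → ℝ) → Matrix ι ι (RatFunc ℝ)}
    (hA : ∀ i k, (fun θ => A θ i k) ∈ rationalSubring D) :
    (fun θ => (A θ).det) ∈ rationalSubring D := by
  have : (fun θ => (A θ).det) = ∑ σ : Equiv.Perm ι, (σ.sign : ℤ) • ∏ i, fun θ => A θ (σ i) i := by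
    ext θ
    simp [Matrix.det_apply, Finset.sum_apply, Finset.prod_apply, Units.smul_def]
  rw [this]
  exact Subring.sum_mem _ fun σ _ => Subring.zsmul_mem _
    (Subring.prod_mem _ fun i _ => hA _ _) _

theorem map_eval_congr {n : ℕ} {S : Set (Fin n)} {a : Polynomial (MvPolynomial (Fin n) ℝ)}
    (ha : ∀ d, a.coeff d ∈ MvPolynomial.supported ℝ S) {θ θ' : Fin n → ℝ}
    (h : ∀ i ∈ S, θ i = θ' i) : a.map (MvPolynomial.eval θ) = a.map (MvPolynomial.eval θ') := by
  ext d
  rw [Polynomial.coeff_map, Polynomial.coeff_map]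
  exact MvPolynomial.eval₂Hom_congr' rfl
    (fun i hi _ => h i (MvPolynomial.mem_supported.1 (ha d) hi)) rfl

theorem det_ne_zero_of_rank_eq {F ι : Type*} [Field F] [Fintype ι] [DecidableEq ι]
    (A : Matrix ι ι F) (h : A.rank = Fintype.card ι) : A.det ≠ 0 := by
  rw [Matrix.rank_eq_finrank_span_row] at h
  have : LinearIndependent F A.row := by
    rw [linearIndependent_iff_card_eq_finrank_span]
    exact h.symm
  rw [Matrix.linearIndependent_rows_iff_isUnit, Matrix.isUnit_iff_isUnit_det] at this
  exact this.ne_zero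

namespace ModelSet

section

variable {W K : Type*} (M : ModelSet W K)

theorem RationalIn.sub_one {S : Set (Fin M.n)} {f : (Fin M.n → ℝ) → RatFunc ℝ}
    (hf : M.RationalIn S f) : M.RationalIn S fun θ => f θ - 1 := by
  obtain ⟨a, b, hS, hab⟩ := hf
  refine ⟨a - b, b, fun d => ⟨?_, (hS d).2⟩, fun θ hθ => ⟨(hab θ hθ).1, ?_⟩⟩
  · rw [Polynomial.coeff_sub]
    exact sub_mem (hS d).1 (hS d).2
  · beta_reduce
    rw [(hab θ hθ).2, Polynomial.map_sub, map_sub, sub_div,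
      div_self (RatFunc.algebraMap_ne_zero (hab θ hθ).1)]

theorem RationalIn.of_isKnown {f : (Fin M.n → ℝ) → RatFunc ℝ} (hf : M.IsKnown f)
    {θ₀ : Fin M.n → ℝ} (hθ₀ : θ₀ ∈ M.Θ) : M.RationalIn ∅ f := by
  refine ⟨(f θ₀).num.map MvPolynomial.C, (f θ₀).denom.map MvPolynomial.C, fun d => ?_,
    fun θ hθ => ?_⟩
  · rw [Polynomial.coeff_map, Polynomial.coeff_map]
    exact ⟨Subalgebra.algebraMap_mem _ _, Subalgebra.algebraMap_mem _ _⟩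
  · have h1 : (MvPolynomial.eval θ).comp MvPolynomial.C = RingHom.id ℝ := by
      ext x; simp
    rw [Polynomial.map_map, Polynomial.map_map, h1, Polynomial.map_id, Polynomial.map_id,
      RatFunc.num_div_denom]
    exact ⟨(f θ₀).denom_ne_zero, hf θ hθ θ₀ hθ₀⟩

end

/-- The entries of `[(G - I)  X]` depend on disjoint sets of parameters. -/
theorem exists_parameter_sets {W K : Type*} [DecidableEq W] (M : ModelSet W K)
    (hIndep : M.IsIndependentlyParameterized)
    {θ₀ : Fin M.n → ℝ} (hθ₀ : θ₀ ∈ M.Θ) :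
    ∃ S : W → M.Vertex → Set (Fin M.n),
      (∀ i v i' v', (i, v) ≠ (i', v') → Disjoint (S i v) (S i' v')) ∧
      (∀ i v, M.RationalIn (S i v) fun θ => M.structureMatrix θ i v) := by
  classical
  obtain ⟨S, hS, hG, hH⟩ := hIndep
  -- Each unknown entry comes from one entry of `G` or `H̃` and inherits its parameters; the
  -- position map makes different entries use different indices. Known entries receive the empty
  -- set.
  have key : ∀ i v, ¬ (M.IsKnown fun θ => M.structureMatrix θ i v) →
      ∃ y : (W × W) ⊕ (M.C × M.C), (Sum.elim (fun p => (p.1, Sum.inl p.2))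
        (fun p => ((p.1 : W), Sum.inr (Sum.inr p.2))) y : W × M.Vertex) = (i, v) ∧
        M.RationalIn (S y) fun θ => M.structureMatrix θ i v := by
    intro i v hv
    rcases v with k | k | k
    · refine ⟨Sum.inl (i, k), rfl, ?_⟩
      by_cases hik : i = k
      · subst hik
        simpa [structureMatrix] using RationalIn.sub_one M (hG i i)
      · simpa [structureMatrix, hik] using hG i k
    · exact absurd (fun θ _ θ' _ => rfl) hv
    · by_cases hi : i ∈ M.C
      · refine ⟨Sum.inr (⟨i, hi⟩, k), rfl, ?_⟩
        simpa [structureMatrix, X, Hp, hi] using hH ⟨i, hi⟩ k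
      · refine absurd (fun θ _ θ' _ => ?_) hv
        simp [structureMatrix, X, Hp, hi]
  choose y hy hyR using key
  refine ⟨fun i v => if h : M.IsKnown fun θ => M.structureMatrix θ i v then ∅ else S (y i v h),
    fun i v i' v' hne => ?_, fun i v => ?_⟩
  · by_cases h : M.IsKnown fun θ => M.structureMatrix θ i v
    · simp [h]
    by_cases h' : M.IsKnown fun θ => M.structureMatrix θ i' v'
    · simp [h']
    simp only [h, h', dite_false]
    refine hS _ _ fun heq => hne ?_
    rw [← hy i v h, ← hy i' v' h', heq]
  · by_cases h : M.IsKnown fun θ => M.structureMatrix θ i v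
    · simp only [h, dite_true]
      exact RationalIn.of_isKnown M h hθ₀
    · simp only [h, dite_false]
      exact hyR i v h

/-- A square submatrix of `[(G - I)  X]` with a transversal of entries not fixed to zero is
generically nonsingular. -/
theorem ae_det_submatrix_ne_zero {W K : Type*} [DecidableEq W] (M : ModelSet W K)
    (hIndep : M.IsIndependentlyParameterized)
    (hFixed : M.FixedSubmatricesHaveStructuralRank) (n : ℕ) (r : Fin n ↪ W) (c : Fin n ↪ M.Vertex)
    (h : ∀ a, ¬ M.IsFixedZero fun θ => M.structureMatrix θ (r a) (c a)) :
    ∀ᵐ θ, θ ∈ M.Θ → ((M.structureMatrix θ).submatrix r c).det ≠ 0 := by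
  classical
  rcases M.Θ.eq_empty_or_nonempty with hΘ | ⟨θ₀, hθ₀⟩
  · simp [hΘ]
  obtain ⟨S, hdisj, hrat⟩ := M.exists_parameter_sets hIndep hθ₀
  choose a b hab hval using hrat
  -- `Θ` need not be closed under recombining parameter components. The larger set `D`, where all
  -- denominators are nonzero, is closed under recombination by blocks, and `A` extends the
  -- structure matrix to it. The nonsingular parameter may lie outside `Θ`; nonvanishing almost
  -- everywhere on `D` still restricts to `Θ`.
  let D : Set (Fin M.n → ℝ) := {θ | ∀ i v, (b i v).map (MvPolynomial.eval θ) ≠ 0}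
  let A : (Fin M.n → ℝ) → Matrix W M.Vertex (RatFunc ℝ) := fun θ => Matrix.of fun i v =>
    algebraMap (Polynomial ℝ) (RatFunc ℝ) ((a i v).map (MvPolynomial.eval θ)) /
        algebraMap (Polynomial ℝ) (RatFunc ℝ) ((b i v).map (MvPolynomial.eval θ))
  have hΘD : M.Θ ⊆ D := fun θ hθ i v => (hval i v θ hθ).1
  have hAs : ∀ θ ∈ M.Θ, A θ = M.structureMatrix θ := by
    intro θ hθ
    ext i v
    exact (hval i v θ hθ).2.symm
  have hAcongr : ∀ i v θ θ', (∀ x ∈ S i v, θ x = θ' x) → A θ i v = A θ' i v := by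
    intro i v θ θ' hx
    simp only [A, Matrix.of_apply]
    rw [map_eval_congr (fun d => (hab i v d).1) hx, map_eval_congr (fun d => (hab i v d).2) hx]
  have hmix : ∀ (E : Set (W × M.Vertex)) (p₁ p₂ : D), ∃ p : D, ∀ i k,
      ((i, k) ∈ E → A p i k = A p₁ i k) ∧ ((i, k) ∉ E → A p i k = A p₂ i k) := by
    intro E p₁ p₂
    let p : Fin M.n → ℝ := fun x => if ∃ e ∈ E, x ∈ S e.1 e.2 then p₁.1 x else p₂.1 x
    have h1 : ∀ i k, (i, k) ∈ E → ∀ x ∈ S i k, p x = p₁.1 x :=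
      fun i k hik x hx => if_pos ⟨(i, k), hik, hx⟩
    have h2 : ∀ i k, (i, k) ∉ E → ∀ x ∈ S i k, p x = p₂.1 x := by
      intro i k hik x hx
      refine if_neg ?_
      rintro ⟨⟨i', k'⟩, he, hx'⟩
      have hne : (i, k) ≠ (i', k') := by rintro heq; exact hik (heq ▸ he)
      exact Set.disjoint_left.1 (hdisj i k i' k' hne) hx hx'
    refine ⟨⟨p, fun i k => ?_⟩, fun i k => ⟨fun hik => hAcongr i k _ _ (h1 i k hik),
      fun hik => hAcongr i k _ _ (h2 i k hik)⟩⟩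
    by_cases hik : (i, k) ∈ E
    · rw [map_eval_congr (fun d => (hab i k d).2) (h1 i k hik)]
      exact p₁.2 i k
    · rw [map_eval_congr (fun d => (hab i k d).2) (h2 i k hik)]
      exact p₂.2 i k
  -- A submatrix constant on `D` is known on `Θ`, and its nonzero diagonal gives it full structural
  -- rank, so the rank hypothesis makes it nonsingular.
  have hconst : ∀ (n : ℕ) (r : Fin n ↪ W) (c : Fin n ↪ M.Vertex),
      (∀ i k (p p' : D), A p (r i) (c k) = A p' (r i) (c k)) →
      (∀ i (p : D), A p (r i) (c i) ≠ 0) → ∀ p : D, ((A p).submatrix r c).det ≠ 0 := by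
    intro n r c hk hd p
    have hp : (A p).submatrix r c = (M.structureMatrix θ₀).submatrix r c := by
      ext i k
      rw [← hAs θ₀ hθ₀]
      exact hk i k p ⟨θ₀, hΘD hθ₀⟩
    rw [hp]
    apply det_ne_zero_of_rank_eq
    rw [Fintype.card_fin]
    let rows : Finset W := Finset.univ.map r
    let cols : Finset M.Vertex := Finset.univ.map c
    let er : Fin n ≃ rows := Equiv.ofBijective (fun i => ⟨r i, by simp [rows]⟩)
      ⟨fun i i' hi => r.injective (congrArg Subtype.val hi), fun ⟨x, hx⟩ => by
        obtain ⟨i, -, rfl⟩ := Finset.mem_map.1 hx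
        exact ⟨i, rfl⟩⟩
    let ec : Fin n ≃ cols := Equiv.ofBijective (fun i => ⟨c i, by simp [cols]⟩)
      ⟨fun i i' hi => c.injective (congrArg Subtype.val hi), fun ⟨x, hx⟩ => by
        obtain ⟨i, -, rfl⟩ := Finset.mem_map.1 hx
        exact ⟨i, rfl⟩⟩
    have hkn : M.IsKnown (fun θ => (M.structureMatrix θ).submatrix
      (fun i : rows => (i : W)) (fun k : cols => (k : M.Vertex))) := by
      intro θ hθ θ' hθ'
      ext i k
      obtain ⟨i, rfl⟩ := er.surjective i
      obtain ⟨k, rfl⟩ := ec.surjective k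
      have := hk i k ⟨θ, hΘD hθ⟩ ⟨θ', hΘD hθ'⟩
      simp only [hAs θ hθ, hAs θ' hθ'] at this
      exact this
    have hrank := hFixed rows cols hkn θ₀ hθ₀
    rw [structuralRank_eq_of_equiv _ er ec fun i => by
      have := hd i ⟨θ₀, hΘD hθ₀⟩
      simp only [hAs θ₀ hθ₀] at this
      exact this] at hrank
    rw [← Matrix.rank_submatrix _ er ec] at hrank
    exact hrank
  have hne : Nonempty D := ⟨⟨θ₀, hΘD hθ₀⟩⟩
  obtain ⟨p, hp⟩ := exists_det_ne_zero_of_mixing (fun p : D => A p) hmix hconst n r c (fun i => by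
    have := h i
    simp only [IsFixedZero, not_forall] at this
    obtain ⟨θ, hθ, hne⟩ := this
    refine ⟨⟨θ, hΘD hθ⟩, ?_⟩
    simp only [hAs θ hθ]
    exact hne)
  have hmem : (fun θ => ((A θ).submatrix r c).det) ∈ rationalSubring D := by
    refine det_mem_rationalSubring fun i k => ⟨a (r i) (c k), b (r i) (c k), fun θ hθ => ?_⟩
    exact ⟨hθ _ _, rfl⟩
  filter_upwards [ae_ne_zero_of_mem_rationalSubring hmem p.2 hp] with θ hθ hθΘ
  rw [← hAs θ hθΘ]
  exact hθ (hΘD hθΘ)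

variable {W K : Type*} [Fintype W] [DecidableEq W] (M : ModelSet W K)

/-- Generically, `T X` has a nonsingular submatrix of the size given by the maximum number of
vertex disjoint paths. -/
theorem ae_exists_det_ne_zero (hIndep : M.IsIndependentlyParameterized)
    (hFixed : M.FixedSubmatricesHaveStructuralRank)
    (hhollow : ∀ θ ∈ M.Θ, ∀ i, M.G θ i i = 0) (hdet : ∀ θ ∈ M.Θ, (1 - M.G θ).det ≠ 0)
    (Xbar : Set M.Ext) (Wbar : Set W) :
    ∃ (w : Fin (M.b Xbar Wbar) ↪ W) (x : Fin (M.b Xbar Wbar) ↪ M.Ext),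
      (∀ a, w a ∈ Wbar) ∧ (∀ a, x a ∈ Xbar) ∧
      ∀ᵐ θ, θ ∈ M.Θ → ((M.T θ * M.X θ).submatrix w x).det ≠ 0 := by
  obtain ⟨w, x, σ, hw, hx, hσx, hσ⟩ := M.exists_perm_of_b Xbar Wbar
  refine ⟨w, x, hw, hx, ?_⟩
  rcases M.Θ.eq_empty_or_nonempty with hΘ | ⟨θ₀, hθ₀⟩
  · simp [hΘ]
  let e := (Fintype.equivFin W).symm
  -- The closed-up paths form a transversal: edges along the paths, and the entry `-1` of `G - I` at
  -- fixed vertices, where hollowness of `G` is needed.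
  have hentry : ∀ i, ¬ M.IsFixedZero fun θ => M.structureMatrix θ (σ i) (M.exchange w x i) := by
    intro i
    by_cases hi : i ∈ Set.range w
    · obtain ⟨a, rfl⟩ := hi
      rw [exchange_apply]
      exact hσx a
    · rw [exchange_of_notMem _ _ _ hi]
      by_cases hii : σ i = i
      · intro h0
        have := h0 θ₀ hθ₀
        simp [structureMatrix, hii, hhollow θ₀ hθ₀] at this
      · have := (hσ i hi).resolve_left hii
        simp only [structureMatrix, Matrix.fromCols_apply_inl, Matrix.sub_apply,
          Matrix.one_apply_ne hii, sub_zero]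
        exact this
  have key := M.ae_det_submatrix_ne_zero hIndep hFixed (Fintype.card W)
    (e.toEmbedding.trans σ.toEmbedding)
    (e.toEmbedding.trans ⟨M.exchange w x, M.exchange_injective w x⟩) (fun a => hentry (e a))
  filter_upwards [key] with θ hθ hθΘ h0
  refine hθ hθΘ ?_
  rw [← M.det_exchange_eq_zero_iff (hdet θ hθΘ)] at h0
  have : (M.structureMatrix θ).submatrix (e.toEmbedding.trans σ.toEmbedding)
      (e.toEmbedding.trans ⟨M.exchange w x, M.exchange_injective w x⟩) =
      (((M.structureMatrix θ).submatrix id (M.exchange w x)).submatrix σ id).submatrix e e := rfl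
  rw [this, Matrix.det_submatrix_equiv_self, Matrix.det_permute, h0, mul_zero]

end ModelSet
end DynNet

namespace DynNet

open Filter Topology

/-! ### Values at infinity -/

/-- `f` is proper and has the value `a` at `z = ∞`. -/
def HasValueAtInfinity (f : RatFunc ℝ) (a : ℝ) : Prop :=
  ∃ p q : Polynomial ℝ, q.Monic ∧ p.natDegree ≤ q.natDegree ∧ p.coeff q.natDegree = a ∧
    f = algebraMap (Polynomial ℝ) (RatFunc ℝ) p / algebraMap (Polynomial ℝ) (RatFunc ℝ) q

theorem IsProper.hasValueAtInfinity {f : RatFunc ℝ} (hf : IsProper f) :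
    HasValueAtInfinity f (atInfinity f) :=
  ⟨f.num, f.denom, f.monic_denom, Polynomial.natDegree_le_natDegree hf, rfl,
    f.num_div_denom.symm⟩

namespace HasValueAtInfinity

/-- The representing fraction need not be reduced; cross-multiplication transfers its degree
inequality to the reduced one. -/
theorem natDegree_num_le {f : RatFunc ℝ} {a : ℝ} (hf : HasValueAtInfinity f a) :
    f.num.natDegree ≤ f.denom.natDegree := by
  obtain ⟨p, q, hq, hpq, -, h⟩ := hf
  have h1 := (RatFunc.num_mul_eq_mul_denom_iff hq.ne_zero).2 h
  by_cases h0 : f.num = 0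
  · simp [h0]
  have hp : p ≠ 0 := by
    rintro rfl
    rw [zero_mul] at h1
    exact mul_ne_zero h0 hq.ne_zero h1
  have h2 := congrArg Polynomial.natDegree h1
  rw [Polynomial.natDegree_mul h0 hq.ne_zero, Polynomial.natDegree_mul hp f.denom_ne_zero] at h2
  omega

theorem unique {f : RatFunc ℝ} {a b : ℝ} (ha : HasValueAtInfinity f a)
    (hb : HasValueAtInfinity f b) : a = b := by
  obtain ⟨p, q, hq, hpq, rfl, h⟩ := ha
  obtain ⟨r, s, hs, hrs, rfl, h'⟩ := hb
  rw [h, div_eq_div_iff (RatFunc.algebraMap_ne_zero hq.ne_zero)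
    (RatFunc.algebraMap_ne_zero hs.ne_zero), ← map_mul, ← map_mul] at h'
  have h2 := RatFunc.algebraMap_injective ℝ h'
  have h3 := congrArg (fun t => Polynomial.coeff t (q.natDegree + s.natDegree)) h2
  rw [Polynomial.coeff_mul_add_eq_of_natDegree_le hpq le_rfl, add_comm q.natDegree,
    Polynomial.coeff_mul_add_eq_of_natDegree_le hrs le_rfl, Polynomial.coeff_natDegree,
    Polynomial.coeff_natDegree, hq.leadingCoeff, hs.leadingCoeff, mul_one, mul_one] at h3
  exact h3

theorem C (a : ℝ) : HasValueAtInfinity (RatFunc.C a) a :=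
  ⟨Polynomial.C a, 1, Polynomial.monic_one, by simp, by simp, by simp⟩

theorem zero : HasValueAtInfinity 0 0 := by simpa using C 0

theorem one : HasValueAtInfinity 1 1 := by simpa using C 1

theorem add {f g : RatFunc ℝ} {a b : ℝ} (hf : HasValueAtInfinity f a)
    (hg : HasValueAtInfinity g b) : HasValueAtInfinity (f + g) (a + b) := by
  obtain ⟨p, q, hq, hpq, rfl, rfl⟩ := hf
  obtain ⟨r, s, hs, hrs, rfl, rfl⟩ := hg
  refine ⟨p * s + q * r, q * s, hq.mul hs, ?_, ?_, ?_⟩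
  · rw [hq.natDegree_mul hs]
    refine (Polynomial.natDegree_add_le _ _).trans (max_le ?_ ?_)
    · exact Polynomial.natDegree_mul_le.trans (by omega)
    · exact Polynomial.natDegree_mul_le.trans (by omega)
  · rw [hq.natDegree_mul hs, Polynomial.coeff_add, Polynomial.coeff_mul_add_eq_of_natDegree_le hpq le_rfl,
      Polynomial.coeff_mul_add_eq_of_natDegree_le le_rfl hrs, Polynomial.coeff_natDegree,
      Polynomial.coeff_natDegree, hq.leadingCoeff, hs.leadingCoeff, mul_one, one_mul]
  · rw [div_add_div _ _ (RatFunc.algebraMap_ne_zero hq.ne_zero)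
      (RatFunc.algebraMap_ne_zero hs.ne_zero)]
    simp

theorem mul {f g : RatFunc ℝ} {a b : ℝ} (hf : HasValueAtInfinity f a)
    (hg : HasValueAtInfinity g b) : HasValueAtInfinity (f * g) (a * b) := by
  obtain ⟨p, q, hq, hpq, rfl, rfl⟩ := hf
  obtain ⟨r, s, hs, hrs, rfl, rfl⟩ := hg
  refine ⟨p * r, q * s, hq.mul hs, ?_, ?_, ?_⟩
  · rw [hq.natDegree_mul hs]
    exact Polynomial.natDegree_mul_le.trans (by omega)
  · rw [hq.natDegree_mul hs, Polynomial.coeff_mul_add_eq_of_natDegree_le hpq hrs]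
  · rw [div_mul_div_comm]
    simp

theorem sub {f g : RatFunc ℝ} {a b : ℝ} (hf : HasValueAtInfinity f a)
    (hg : HasValueAtInfinity g b) : HasValueAtInfinity (f - g) (a - b) := by
  have := hf.add ((C (-1)).mul hg)
  simpa [sub_eq_add_neg] using this

theorem inv {f : RatFunc ℝ} {a : ℝ} (hf : HasValueAtInfinity f a) (ha : a ≠ 0) :
    HasValueAtInfinity f⁻¹ a⁻¹ := by
  obtain ⟨p, q, hq, hpq, rfl, rfl⟩ := hf
  have hdeg : p.natDegree = q.natDegree :=
    le_antisymm hpq (Polynomial.le_natDegree_of_ne_zero ha)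
  have hlead : p.leadingCoeff = p.coeff q.natDegree := by
    rw [Polynomial.leadingCoeff, hdeg]
  rw [← hlead] at ha ⊢
  have hc : IsUnit p.leadingCoeff⁻¹ := (inv_ne_zero ha).isUnit
  refine ⟨Polynomial.C p.leadingCoeff⁻¹ * q, Polynomial.C p.leadingCoeff⁻¹ * p, ?_, ?_, ?_, ?_⟩
  · rw [Polynomial.Monic, Polynomial.leadingCoeff_mul, Polynomial.leadingCoeff_C,
      inv_mul_cancel₀ ha]
  · rw [Polynomial.natDegree_C_mul hc.ne_zero, Polynomial.natDegree_C_mul hc.ne_zero, hdeg]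
  · rw [Polynomial.natDegree_C_mul hc.ne_zero, hdeg, Polynomial.coeff_C_mul,
      Polynomial.coeff_natDegree, hq.leadingCoeff, mul_one]
  · rw [inv_div, map_mul, map_mul, mul_div_mul_left]
    exact RatFunc.algebraMap_ne_zero (Polynomial.C_ne_zero.2 hc.ne_zero)

theorem sum {ι : Type*} (s : Finset ι) {f : ι → RatFunc ℝ} {a : ι → ℝ}
    (h : ∀ i ∈ s, HasValueAtInfinity (f i) (a i)) :
    HasValueAtInfinity (∑ i ∈ s, f i) (∑ i ∈ s, a i) := by
  classical
  induction s using Finset.induction_on with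
  | empty => simpa using zero
  | insert i s hi ih =>
    rw [Finset.sum_insert hi, Finset.sum_insert hi]
    exact (h i (Finset.mem_insert_self _ _)).add
      (ih fun k hk => h k (Finset.mem_insert_of_mem hk))

theorem prod {ι : Type*} (s : Finset ι) {f : ι → RatFunc ℝ} {a : ι → ℝ}
    (h : ∀ i ∈ s, HasValueAtInfinity (f i) (a i)) :
    HasValueAtInfinity (∏ i ∈ s, f i) (∏ i ∈ s, a i) := by
  classical
  induction s using Finset.induction_on with
  | empty => simpa using one
  | insert i s hi ih =>
    rw [Finset.prod_insert hi, Finset.prod_insert hi]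
    exact (h i (Finset.mem_insert_self _ _)).mul
      (ih fun k hk => h k (Finset.mem_insert_of_mem hk))

theorem matrix_mul {ι κ μ : Type*} [Fintype κ] {A : Matrix ι κ (RatFunc ℝ)} {B : Matrix κ μ (RatFunc ℝ)} {a : Matrix ι κ ℝ}
    {b : Matrix κ μ ℝ} (hA : ∀ i k, HasValueAtInfinity (A i k) (a i k))
    (hB : ∀ i k, HasValueAtInfinity (B i k) (b i k)) (i : ι) (k : μ) :
    HasValueAtInfinity ((A * B) i k) ((a * b) i k) := by
  rw [Matrix.mul_apply, Matrix.mul_apply]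
  exact sum _ fun l _ => (hA i l).mul (hB l k)

variable {ι : Type*} [Fintype ι] [DecidableEq ι]

theorem matrix_det {A : Matrix ι ι (RatFunc ℝ)} {a : Matrix ι ι ℝ}
    (hA : ∀ i k, HasValueAtInfinity (A i k) (a i k)) : HasValueAtInfinity A.det a.det := by
  rw [Matrix.det_apply', Matrix.det_apply']
  refine sum _ fun σ _ => mul ?_ (prod _ fun i _ => hA _ _)
  simpa using C (σ.sign : ℝ)

theorem matrix_inv {A : Matrix ι ι (RatFunc ℝ)} {a : Matrix ι ι ℝ}
    (hA : ∀ i k, HasValueAtInfinity (A i k) (a i k)) (ha : a.det ≠ 0) (i k : ι) :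
    HasValueAtInfinity (A⁻¹ i k) (a⁻¹ i k) := by
  rw [Matrix.inv_def, Matrix.inv_def, Ring.inverse_eq_inv', Ring.inverse_eq_inv']
  refine mul ((matrix_det hA).inv ha) ?_
  rw [Matrix.adjugate_apply, Matrix.adjugate_apply]
  refine matrix_det fun i' k' => ?_
  rw [Matrix.updateRow_apply, Matrix.updateRow_apply]
  by_cases h : i' = k
  · simp only [h, if_true, Pi.single_apply]
    by_cases h' : k' = i
    · simpa [h'] using one
    · simpa [h'] using zero
  · simpa [h] using hA i' k'

theorem matrix_one {ι : Type*} [DecidableEq ι] (i k : ι) :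
    HasValueAtInfinity ((1 : Matrix ι ι (RatFunc ℝ)) i k) ((1 : Matrix ι ι ℝ) i k) := by
  by_cases h : i = k
  · subst h
    rw [Matrix.one_apply_eq, Matrix.one_apply_eq]
    exact one
  · rw [Matrix.one_apply_ne h, Matrix.one_apply_ne h]
    exact zero

theorem det_ne_zero {A : Matrix ι ι (RatFunc ℝ)} {a : Matrix ι ι ℝ}
    (hA : ∀ i k, HasValueAtInfinity (A i k) (a i k)) (ha : a.det ≠ 0) : A.det ≠ 0 := by
  intro h
  have := matrix_det hA
  rw [h] at this
  exact ha (this.unique zero)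

end HasValueAtInfinity

/-! ### Poles and evaluation -/

/-- The reduced denominator divides `q`. -/
theorem not_isPole_div {p q : Polynomial ℝ} (z : ℂ) (hz : Polynomial.aeval z q ≠ 0) :
    ¬ IsPole (algebraMap (Polynomial ℝ) (RatFunc ℝ) p / algebraMap (Polynomial ℝ) (RatFunc ℝ) q)
      z := by
  intro h
  apply hz
  obtain ⟨r, hr⟩ := RatFunc.denom_div_dvd p q
  rw [hr, map_mul, h, zero_mul]

theorem eval_div_of_ne_zero {p q : Polynomial ℝ} (z : ℂ) (hz : Polynomial.aeval z q ≠ 0) :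
    (algebraMap (Polynomial ℝ) (RatFunc ℝ) p / algebraMap (Polynomial ℝ) (RatFunc ℝ) q).eval
      (algebraMap ℝ ℂ) z = Polynomial.aeval z p / Polynomial.aeval z q := by
  have hq : q ≠ 0 := by rintro rfl; simp at hz
  set f := algebraMap (Polynomial ℝ) (RatFunc ℝ) p / algebraMap (Polynomial ℝ) (RatFunc ℝ) q
  have h1 : f.num * q = p * f.denom := (RatFunc.num_mul_eq_mul_denom_iff hq).2 rfl
  have h2 := congrArg (Polynomial.aeval z) h1
  rw [map_mul, map_mul] at h2
  have h3 : Polynomial.aeval z f.denom ≠ 0 := not_isPole_div z hz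
  rw [RatFunc.eval, ← Polynomial.aeval_def, ← Polynomial.aeval_def, div_eq_div_iff h3 hz, h2]

/-- The transfer functions without a pole at `z`. -/
def regularAt (z : ℂ) : Subring (RatFunc ℝ) where
  carrier := {f | ¬ IsPole f z}
  zero_mem' := by simp [IsPole]
  one_mem' := by simp [IsPole]
  add_mem' := by
    intro f g hf hg h
    obtain ⟨r, hr⟩ := RatFunc.denom_add_dvd f g
    have := congrArg (Polynomial.aeval z) hr
    rw [map_mul, map_mul, h, zero_mul] at this
    exact mul_ne_zero hf hg this
  mul_mem' := by
    intro f g hf hg h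
    obtain ⟨r, hr⟩ := RatFunc.denom_mul_dvd f g
    have := congrArg (Polynomial.aeval z) hr
    rw [map_mul, map_mul, h, zero_mul] at this
    exact mul_ne_zero hf hg this
  neg_mem' := by
    intro f hf
    have h1 : -f = algebraMap (Polynomial ℝ) (RatFunc ℝ) (-f.num) /
        algebraMap (Polynomial ℝ) (RatFunc ℝ) f.denom := by
      rw [map_neg, neg_div, RatFunc.num_div_denom]
    change ¬ IsPole (-f) z
    rw [h1]
    exact not_isPole_div z hf

theorem mem_regularAt {f : RatFunc ℝ} {z : ℂ} : f ∈ regularAt z ↔ ¬ IsPole f z := Iff.rfl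

theorem C_mem_regularAt (a : ℝ) (z : ℂ) : RatFunc.C a ∈ regularAt z := by
  simp [mem_regularAt, IsPole]

/-- Evaluation at `z`, as a ring homomorphism on the transfer functions without a pole at `z`. -/
noncomputable def evalHom (z : ℂ) : regularAt z →+* ℂ where
  toFun f := (f : RatFunc ℝ).eval (algebraMap ℝ ℂ) z
  map_zero' := RatFunc.eval_zero _ _
  map_one' := RatFunc.eval_one _ _
  map_add' f g := RatFunc.eval_add _ _ f.2 g.2
  map_mul' f g := RatFunc.eval_mul _ _ f.2 g.2

/-- Entrywise evaluation of a transfer matrix. -/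
noncomputable def evalMatrix {ι κ : Type*} (z : ℂ) (A : Matrix ι κ (RatFunc ℝ)) : Matrix ι κ ℂ :=
  A.map fun f => f.eval (algebraMap ℝ ℂ) z

theorem mul_mem_regularAt {ι κ μ : Type*} [Fintype κ] {A : Matrix ι κ (RatFunc ℝ)}
    {B : Matrix κ μ (RatFunc ℝ)} {z : ℂ} (hA : ∀ i k, A i k ∈ regularAt z)
    (hB : ∀ i k, B i k ∈ regularAt z) (i : ι) (k : μ) : (A * B) i k ∈ regularAt z := by
  rw [Matrix.mul_apply]
  exact Subring.sum_mem _ fun l _ => Subring.mul_mem _ (hA i l) (hB l k)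

theorem evalMatrix_mul {ι κ μ : Type*} [Fintype κ] {A : Matrix ι κ (RatFunc ℝ)}
    {B : Matrix κ μ (RatFunc ℝ)} {z : ℂ} (hA : ∀ i k, A i k ∈ regularAt z)
    (hB : ∀ i k, B i k ∈ regularAt z) :
    evalMatrix z (A * B) = evalMatrix z A * evalMatrix z B := by
  ext i k
  have h : (A * B) i k = ((∑ l, (⟨A i l, hA i l⟩ * ⟨B l k, hB l k⟩ : regularAt z) :
      regularAt z) : RatFunc ℝ) := by
    rw [Matrix.mul_apply, AddSubmonoidClass.coe_finsetSum]
    rfl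
  change ((A * B) i k).eval _ _ = _
  rw [h]
  change evalHom z _ = _
  rw [map_sum, Matrix.mul_apply]
  refine Finset.sum_congr rfl fun l _ => ?_
  rw [map_mul]
  rfl

theorem evalMatrix_one {ι : Type*} [DecidableEq ι] (z : ℂ) :
    evalMatrix z (1 : Matrix ι ι (RatFunc ℝ)) = 1 := by
  ext i k
  by_cases h : i = k
  · subst h; simp [evalMatrix]
  · simp [evalMatrix, h]

theorem evalMatrix_map_C {ι κ : Type*} (z : ℂ) (A : Matrix ι κ ℝ) :
    evalMatrix z (A.map RatFunc.C) = A.map (algebraMap ℝ ℂ) := by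
  ext i k
  simp [evalMatrix]

theorem eventually_aeval_ne_zero {p : Polynomial ℝ} (hp : p ≠ 0) :
    ∀ᶠ z : ℂ in cofinite, Polynomial.aeval z p ≠ 0 := by
  rw [eventually_cofinite]
  refine (p.rootSet_finite ℂ).subset fun z hz => ?_
  rw [Polynomial.mem_rootSet]
  exact ⟨hp, by simpa using hz⟩

theorem eventually_mem_regularAt (f : RatFunc ℝ) : ∀ᶠ z : ℂ in cofinite, f ∈ regularAt z :=
  eventually_aeval_ne_zero f.denom_ne_zero

theorem eventually_matrix_mem_regularAt {ι κ : Type*} [Finite ι] [Finite κ]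
    (A : Matrix ι κ (RatFunc ℝ)) : ∀ᶠ z : ℂ in cofinite, ∀ i k, A i k ∈ regularAt z :=
  eventually_all.2 fun i => eventually_all.2 fun k => eventually_mem_regularAt (A i k)

/-! ### The unit circle -/

/-- The filter of cofinite subsets of the unit circle. -/
def circleCofinite : Filter ℂ := cofinite ⊓ 𝓟 {z | ‖z‖ = 1}

/-- Rotate `z₀` by the angles `1 / (n + 1)`, distinct in `(-π, π]`. The resulting points leave every
finite set, so estimates valid off finitely many points pass to `z₀` by continuity. -/
theorem exists_tendsto_circleCofinite {z₀ : ℂ} (h : ‖z₀‖ = 1) :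
    ∃ u : ℕ → ℂ, Tendsto u atTop circleCofinite ∧ Tendsto u atTop (𝓝 z₀) := by
  have hz₀ : z₀ ≠ 0 := by rintro rfl; simp at h
  let u : ℕ → ℂ := fun n => z₀ * Complex.exp (((1 / ((n : ℝ) + 1) : ℝ) : ℂ) * Complex.I)
  have hinj : Function.Injective u := by
    intro n m hnm
    have h1 := mul_left_cancel₀ hz₀ hnm
    have hb : ∀ n : ℕ, -Real.pi < 1 / ((n : ℝ) + 1) ∧ 1 / ((n : ℝ) + 1) ≤ Real.pi := by
      intro n
      have hpos : 0 < 1 / ((n : ℝ) + 1) := by positivity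
      have hle : 1 / ((n : ℝ) + 1) ≤ 1 := by
        rw [div_le_one (by positivity)]
        linarith [(Nat.cast_nonneg n : (0 : ℝ) ≤ n)]
      have := Real.pi_gt_three
      constructor <;> linarith
    have him : ∀ t : ℝ, ((t : ℂ) * Complex.I).im = t := fun t => by simp
    have h2 := Complex.exp_inj_of_neg_pi_lt_of_le_pi (by rw [him]; exact (hb n).1)
      (by rw [him]; exact (hb n).2) (by rw [him]; exact (hb m).1) (by rw [him]; exact (hb m).2) h1
    have h3 := mul_right_cancel₀ Complex.I_ne_zero h2
    have h4 : 1 / ((n : ℝ) + 1) = 1 / ((m : ℝ) + 1) := by exact_mod_cast h3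
    have h5 : (n : ℝ) + 1 = (m : ℝ) + 1 := by simpa using h4
    exact_mod_cast (add_left_injective 1 h5)
  refine ⟨u, tendsto_inf.2 ⟨?_, ?_⟩, ?_⟩
  · rw [← Nat.cofinite_eq_atTop]
    exact hinj.tendsto_cofinite
  · refine tendsto_principal.2 (Eventually.of_forall fun n => ?_)
    change ‖_ * _‖ = 1
    rw [norm_mul, Complex.norm_exp_ofReal_mul_I, h, one_mul]
  · have h1 : Tendsto (fun n : ℕ => 1 / ((n : ℝ) + 1)) atTop (𝓝 0) :=
      tendsto_one_div_add_atTop_nhds_zero_nat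
    have h2 : Continuous fun t : ℝ => z₀ * Complex.exp ((t : ℂ) * Complex.I) := by fun_prop
    have h3 := (h2.tendsto 0).comp h1
    simp only [Complex.ofReal_zero, zero_mul, Complex.exp_zero, mul_one] at h3
    exact h3

instance : circleCofinite.NeBot := by
  obtain ⟨u, hu, -⟩ := exists_tendsto_circleCofinite (z₀ := 1) (by simp)
  exact hu.neBot

theorem eventually_circleCofinite_norm : ∀ᶠ z in circleCofinite, ‖z‖ = 1 :=
  (eventually_principal.2 fun _ h => h).filter_mono inf_le_right

/-- Two transfer functions that agree at almost all points of the unit circle are equal. -/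
theorem eq_of_eventually_eval_eq {f g : RatFunc ℝ}
    (h : ∀ᶠ z in circleCofinite, f.eval (algebraMap ℝ ℂ) z = g.eval (algebraMap ℝ ℂ) z) :
    f = g := by
  by_contra hne
  have h0 : f.num * g.denom - g.num * f.denom ≠ 0 := by
    intro h0
    apply hne
    rw [← f.num_div_denom, ← g.num_div_denom, div_eq_div_iff
      (RatFunc.algebraMap_ne_zero f.denom_ne_zero) (RatFunc.algebraMap_ne_zero g.denom_ne_zero),
      ← map_mul, ← map_mul, sub_eq_zero.1 h0]
  obtain ⟨z, hz, hf, hg, h1⟩ := (h.and (((eventually_mem_regularAt f).and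
    ((eventually_mem_regularAt g).and (eventually_aeval_ne_zero h0))).filter_mono
      inf_le_left)).exists
  apply h1
  rw [RatFunc.eval, RatFunc.eval, ← Polynomial.aeval_def, ← Polynomial.aeval_def,
    ← Polynomial.aeval_def, ← Polynomial.aeval_def, div_eq_div_iff hf hg] at hz
  rw [map_sub, map_mul, map_mul, hz, sub_self]

/-- A transfer function that is bounded on the unit circle has no poles there. -/
theorem mem_regularAt_of_eventually_norm_le {f : RatFunc ℝ} {c : ℝ}
    (h : ∀ᶠ z in circleCofinite, ‖f.eval (algebraMap ℝ ℂ) z‖ ≤ c) {z₀ : ℂ} (hz₀ : ‖z₀‖ = 1) :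
    f ∈ regularAt z₀ := by
  intro hpole
  obtain ⟨u, hu, hu'⟩ := exists_tendsto_circleCofinite hz₀
  -- Cleared of denominators, the bound is continuous and extends to `z₀`. A pole there would be a
  -- common zero of coprime polynomials.
  have h1 : ∀ᶠ z in circleCofinite,
      ‖Polynomial.aeval z f.num‖ ≤ c * ‖Polynomial.aeval z f.denom‖ := by
    filter_upwards [h, (eventually_mem_regularAt f).filter_mono inf_le_left] with z hz hz'
    have hz'' : Polynomial.aeval z f.denom ≠ 0 := hz'
    rwa [RatFunc.eval, ← Polynomial.aeval_def, ← Polynomial.aeval_def, norm_div,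
      div_le_iff₀ (norm_pos_iff.2 hz'')] at hz
  have h2 : ‖Polynomial.aeval z₀ f.num‖ ≤ c * ‖Polynomial.aeval z₀ f.denom‖ := by
    refine le_of_tendsto_of_tendsto (b := atTop) ?_ ?_ (hu.eventually h1)
    · exact ((f.num.continuous_aeval.norm).tendsto z₀).comp hu'
    · exact (((f.denom.continuous_aeval.norm).const_mul c).tendsto z₀).comp hu'
  have h3 : Polynomial.aeval z₀ f.denom = 0 := hpole
  rw [h3, norm_zero, mul_zero] at h2
  have h4 : Polynomial.aeval z₀ f.num = 0 := norm_le_zero_iff.1 h2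
  obtain ⟨a, b, hab⟩ := f.isCoprime_num_denom
  have := congrArg (Polynomial.aeval z₀) hab
  simp [h3, h4] at this

/-- A proper transfer function without poles is constant. -/
theorem HasValueAtInfinity.eq_C {f : RatFunc ℝ} {a : ℝ} (hf : HasValueAtInfinity f a)
    (h : ∀ z, f ∈ regularAt z) : f = RatFunc.C a := by
  have h1 : f.denom.natDegree = 0 := by
    by_contra h0
    obtain ⟨z, hz⟩ := IsAlgClosed.exists_aeval_eq_zero ℂ f.denom
      (fun hd => h0 (Polynomial.natDegree_eq_of_degree_eq_some hd))
    exact h z hz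
  have h2 : f.denom = 1 := Polynomial.eq_one_of_monic_natDegree_zero f.monic_denom h1
  have h3 : f.num = Polynomial.C (f.num.coeff 0) :=
    Polynomial.eq_C_of_natDegree_eq_zero (by have := hf.natDegree_num_le; omega)
  have h4 : f = RatFunc.C (f.num.coeff 0) := by
    conv_lhs => rw [← f.num_div_denom, h2, map_one, div_one, h3, RatFunc.algebraMap_C]
  rw [h4] at hf ⊢
  rw [hf.unique (HasValueAtInfinity.C _)]

/-- The transfer function `z ↦ f(1/z)`, which is the complex conjugate of `f` on the unit circle. -/
theorem exists_reciprocal {f : RatFunc ℝ} {a : ℝ} (hf : HasValueAtInfinity f a)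
    (hreg : ∀ z : ℂ, 1 < ‖z‖ → f ∈ regularAt z) :
    ∃ g : RatFunc ℝ, (∀ z : ℂ, ‖z‖ < 1 → g ∈ regularAt z) ∧
      ∀ z : ℂ, ‖z‖ = 1 → f ∈ regularAt z →
        g.eval (algebraMap ℝ ℂ) z = star (f.eval (algebraMap ℝ ℂ) z) := by
  set N := f.denom.natDegree with hN
  have key : ∀ (p : Polynomial ℝ) (z : ℂ), p.natDegree ≤ N → z ≠ 0 →
      Polynomial.aeval z (p.reflect N) * (z⁻¹) ^ N = Polynomial.aeval z⁻¹ p := by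
    intro p z hp hz
    let : Invertible (z⁻¹) := invertibleOfNonzero (inv_ne_zero hz)
    have := Polynomial.eval₂_reflect_mul_pow (algebraMap ℝ ℂ) (z⁻¹) N p hp
    rwa [invOf_eq_inv, inv_inv] at this
  -- Reflecting both polynomials in the same degree `N` realizes `f(1/z)`; properness lets `N` serve
  -- the numerator too. At `z = 0` the new denominator is the leading coefficient `1` of the old
  -- one.
  refine ⟨algebraMap (Polynomial ℝ) (RatFunc ℝ) (f.num.reflect N) /
    algebraMap (Polynomial ℝ) (RatFunc ℝ) (f.denom.reflect N), fun z hz => ?_, fun z hz hfz => ?_⟩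
  · refine not_isPole_div z fun h0 => ?_
    by_cases hz0 : z = 0
    · subst hz0
      rw [Polynomial.aeval_def, Polynomial.eval₂_at_zero, Polynomial.coeff_reflect,
        Polynomial.revAt_zero, Polynomial.coeff_natDegree, f.monic_denom.leadingCoeff] at h0
      simp at h0
    · have h1 := key f.denom z le_rfl hz0
      rw [h0, zero_mul] at h1
      refine hreg z⁻¹ ?_ h1.symm
      rw [norm_inv]
      exact (one_lt_inv₀ (norm_pos_iff.2 hz0)).2 hz
  · have hz0 : z ≠ 0 := by rintro rfl; simp at hz
    have hconj : z⁻¹ = (starRingEnd ℂ) z := Complex.inv_eq_conj hz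
    have hd := key f.denom z le_rfl hz0
    have hn := key f.num z hf.natDegree_num_le hz0
    rw [hconj, Polynomial.aeval_conj] at hd hn
    have hfz' : Polynomial.aeval z f.denom ≠ 0 := hfz
    have hd0 : Polynomial.aeval z (f.denom.reflect N) ≠ 0 := by
      intro h0
      rw [h0, zero_mul] at hd
      exact hfz' ((map_eq_zero _).1 hd.symm)
    have hc0 : ((starRingEnd ℂ) z) ^ N ≠ 0 := by
      rw [← hconj]
      exact pow_ne_zero _ (inv_ne_zero hz0)
    rw [eval_div_of_ne_zero z hd0, RatFunc.eval, ← Polynomial.aeval_def, ← Polynomial.aeval_def,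
      ← starRingEnd_apply, map_div₀, ← hd, ← hn, mul_div_mul_right _ _ hc0]

end DynNet

/-! ### Uniqueness of spectral factors -/

namespace DynNet

open Filter Topology

section SpectralFactorization

variable {ι : Type*} [Fintype ι] [DecidableEq ι]

theorem evalMatrix_mul_eq_one {A B : Matrix ι ι (RatFunc ℝ)} {z : ℂ} (h : A * B = 1)
    (hA : ∀ i k, A i k ∈ regularAt z) (hB : ∀ i k, B i k ∈ regularAt z) :
    evalMatrix z A * evalMatrix z B = 1 := by
  rw [← evalMatrix_mul hA hB, h, evalMatrix_one]

/-- Two stable minimum phase matrices with `F₀ F₀^⋆ = F₁ F₁^⋆` on the unit circle differ by a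
constant orthogonal matrix. -/
theorem exists_orthogonal_of_eq_on_circle {F₀ F₁ : Matrix ι ι (RatFunc ℝ)} {A₀ A₁ : Matrix ι ι ℝ}
    (hF₀ : ∀ z : ℂ, 1 ≤ ‖z‖ → ∀ i k, F₀ i k ∈ regularAt z)
    (hF₁ : ∀ z : ℂ, 1 ≤ ‖z‖ → ∀ i k, F₁ i k ∈ regularAt z)
    (hI₀ : ∀ z : ℂ, 1 < ‖z‖ → ∀ i k, F₀⁻¹ i k ∈ regularAt z)
    (hI₁ : ∀ z : ℂ, 1 < ‖z‖ → ∀ i k, F₁⁻¹ i k ∈ regularAt z)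
    (hA₀ : ∀ i k, HasValueAtInfinity (F₀ i k) (A₀ i k))
    (hA₁ : ∀ i k, HasValueAtInfinity (F₁ i k) (A₁ i k))
    (hd₀ : A₀.det ≠ 0) (hd₁ : A₁.det ≠ 0)
    (h : ∀ z : ℂ, ‖z‖ = 1 → evalMatrix z F₀ * (evalMatrix z F₀)ᴴ =
      evalMatrix z F₁ * (evalMatrix z F₁)ᴴ) :
    ∃ U : Matrix ι ι ℝ, F₀ = F₁ * U.map RatFunc.C ∧ U * Uᵀ = 1 := by
  have hu₀ : IsUnit F₀.det := (HasValueAtInfinity.det_ne_zero hA₀ hd₀).isUnit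
  have hu₁ : IsUnit F₁.det := (HasValueAtInfinity.det_ne_zero hA₁ hd₁).isUnit
  set U := F₁⁻¹ * F₀ with hU
  set V := F₀⁻¹ * F₁ with hV
  have hUV : U * V = 1 := by
    rw [hU, hV, Matrix.mul_assoc, Matrix.mul_nonsing_inv_cancel_left _ _ hu₀,
      Matrix.nonsing_inv_mul _ hu₁]
  have hF₀U : F₀ = F₁ * U := by rw [hU, Matrix.mul_nonsing_inv_cancel_left _ _ hu₁]
  have hVreg : ∀ z : ℂ, 1 < ‖z‖ → ∀ i k, V i k ∈ regularAt z :=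
    fun z hz => mul_mem_regularAt (hI₀ z hz) (hF₁ z hz.le)
  have hUval := HasValueAtInfinity.matrix_mul (HasValueAtInfinity.matrix_inv hA₁ hd₁) hA₀
  have hVval := HasValueAtInfinity.matrix_mul (HasValueAtInfinity.matrix_inv hA₀ hd₀) hA₁
  -- Minimum phase permits poles of `F₁⁻¹` on the circle itself, so unitarity of `U` is first
  -- obtained off a finite set.
  have hcirc : ∀ᶠ z in circleCofinite, evalMatrix z U * (evalMatrix z U)ᴴ = 1 := by
    filter_upwards [eventually_circleCofinite_norm,
      (eventually_matrix_mem_regularAt F₁⁻¹).filter_mono inf_le_left] with z hz hz'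
    have h1 := evalMatrix_mul_eq_one (Matrix.nonsing_inv_mul _ hu₁) hz' (hF₁ z hz.ge)
    have h2 : (evalMatrix z F₁)ᴴ * (evalMatrix z F₁⁻¹)ᴴ = 1 := by
      rw [← Matrix.conjTranspose_mul, h1, Matrix.conjTranspose_one]
    rw [hU, evalMatrix_mul hz' (hF₀ z hz.ge), Matrix.conjTranspose_mul, Matrix.mul_assoc,
      ← Matrix.mul_assoc (evalMatrix z F₀), h z hz, Matrix.mul_assoc, h2, Matrix.mul_one, h1]
  have hrec := fun i k => exists_reciprocal (hVval i k) (fun z hz => hVreg z hz i k)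
  choose g hg hgV using hrec
  -- On the circle the inverse `V` is the conjugate transpose of `U`. So `U` is the reflected
  -- transpose of `V`, which carries regularity of `V` outside the disc to `U` inside.
  have hUg : ∀ i k, U i k = g k i := by
    intro i k
    refine eq_of_eventually_eval_eq ?_
    filter_upwards [hcirc, eventually_circleCofinite_norm,
      (eventually_matrix_mem_regularAt U).filter_mono inf_le_left,
      (eventually_matrix_mem_regularAt V).filter_mono inf_le_left] with z h1 hz hUz hVz
    have h2 := evalMatrix_mul_eq_one hUV hUz hVz
    have h3 : (evalMatrix z U)ᴴ = evalMatrix z V := by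
      rw [← Matrix.inv_eq_right_inv h1, Matrix.inv_eq_right_inv h2]
    have h4 : evalMatrix z U = (evalMatrix z V)ᴴ := by
      rw [← h3, Matrix.conjTranspose_conjTranspose]
    rw [hgV k i z hz (hVz k i)]
    exact congrFun (congrFun h4 i) k
  have hbound : ∀ i k, ∀ᶠ z in circleCofinite, ‖(U i k).eval (algebraMap ℝ ℂ) z‖ ≤ 1 := by
    intro i k
    filter_upwards [hcirc] with z h1
    have h2 := congrFun (congrFun h1 i) i
    rw [Matrix.mul_apply, Matrix.one_apply_eq] at h2
    have h3 : ∑ l, ‖evalMatrix z U i l‖ ^ 2 = (1 : ℝ) := by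
      have : ((∑ l, ‖evalMatrix z U i l‖ ^ 2 : ℝ) : ℂ) = 1 := by
        rw [← h2, Complex.ofReal_sum]
        refine Finset.sum_congr rfl fun l _ => ?_
        rw [Matrix.conjTranspose_apply, ← starRingEnd_apply, Complex.mul_conj,
          Complex.normSq_eq_norm_sq]
      exact_mod_cast this
    have h4 : ‖evalMatrix z U i k‖ ^ 2 ≤ 1 := by
      rw [← h3]
      exact Finset.single_le_sum (f := fun l => ‖evalMatrix z U i l‖ ^ 2)
        (fun l _ => by positivity) (Finset.mem_univ k)
    change ‖evalMatrix z U i k‖ ≤ 1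
    exact (sq_le_one_iff₀ (norm_nonneg _)).1 h4
  -- Inside by reflection, on the circle because rows of a unitary matrix have norm one, outside by
  -- minimum phase. Being proper, `U` is constant.
  have hUreg : ∀ i k z, U i k ∈ regularAt z := by
    intro i k z
    rcases lt_trichotomy ‖z‖ 1 with hz | hz | hz
    · rw [hUg]
      exact hg k i z hz
    · exact mem_regularAt_of_eventually_norm_le (hbound i k) hz
    · exact mul_mem_regularAt (hI₁ z hz) (hF₀ z hz.le) i k
  have hUC : U = (A₁⁻¹ * A₀).map RatFunc.C := by
    ext i k
    exact (hUval i k).eq_C (hUreg i k)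
  refine ⟨A₁⁻¹ * A₀, hUC ▸ hF₀U, ?_⟩
  obtain ⟨z, hz⟩ := hcirc.exists
  rw [hUC, evalMatrix_map_C] at hz
  have h5 : ((A₁⁻¹ * A₀) * (A₁⁻¹ * A₀)ᵀ).map (algebraMap ℝ ℂ) =
      (1 : Matrix ι ι ℝ).map (algebraMap ℝ ℂ) := by
    rw [Matrix.map_mul, Matrix.map_one _ (map_zero _) (map_one _), ← hz]
    congr 1
    ext i k
    rw [Matrix.conjTranspose_apply, Matrix.map_apply, Matrix.map_apply, Matrix.transpose_apply]
    simp
  exact Matrix.map_injective (algebraMap ℝ ℂ).injective h5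

open scoped MatrixOrder in
theorem exists_mul_transpose_of_posSemidef {Λ : Matrix ι ι ℝ} (hΛ : Λ.PosSemidef)
    (hd : Λ.det ≠ 0) : ∃ B : Matrix ι ι ℝ, Λ = B * Bᵀ ∧ B.det ≠ 0 := by
  obtain ⟨B, rfl⟩ := CStarAlgebra.nonneg_iff_eq_star_mul_self.1 hΛ.nonneg
  rw [Matrix.det_mul] at hd
  refine ⟨star B, ?_, left_ne_zero_of_mul hd⟩
  rw [Matrix.star_eq_conjTranspose, Matrix.conjTranspose_eq_transpose_of_trivial,
    Matrix.transpose_transpose]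

theorem map_C_mem_regularAt {ι : Type*} (B : Matrix ι ι ℝ) (z : ℂ) (i k : ι) :
    (B.map RatFunc.C : Matrix ι ι (RatFunc ℝ)) i k ∈ regularAt z := C_mem_regularAt _ _

theorem inv_map_C {B : Matrix ι ι ℝ} (hB : B.det ≠ 0) :
    (B.map RatFunc.C : Matrix ι ι (RatFunc ℝ))⁻¹ = B⁻¹.map RatFunc.C := by
  refine Matrix.inv_eq_left_inv ?_
  rw [← Matrix.map_mul, Matrix.nonsing_inv_mul _ hB.isUnit,
    Matrix.map_one _ (map_zero _) (map_one _)]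

/-- Uniqueness of spectral factors: two stable minimum phase spectral factors of the same spectrum
differ by a constant matrix. -/
theorem exists_constant_of_spectrum_eq {F₀ F₁ : Matrix ι ι (RatFunc ℝ)} {A₀ A₁ : Matrix ι ι ℝ}
    (hF₀ : ∀ z : ℂ, 1 ≤ ‖z‖ → ∀ i k, F₀ i k ∈ regularAt z)
    (hF₁ : ∀ z : ℂ, 1 ≤ ‖z‖ → ∀ i k, F₁ i k ∈ regularAt z)
    (hI₀ : ∀ z : ℂ, 1 < ‖z‖ → ∀ i k, F₀⁻¹ i k ∈ regularAt z)
    (hI₁ : ∀ z : ℂ, 1 < ‖z‖ → ∀ i k, F₁⁻¹ i k ∈ regularAt z)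
    (hA₀ : ∀ i k, HasValueAtInfinity (F₀ i k) (A₀ i k))
    (hA₁ : ∀ i k, HasValueAtInfinity (F₁ i k) (A₁ i k))
    (hd₀ : A₀.det ≠ 0) (hd₁ : A₁.det ≠ 0) {Λ₀ Λ₁ : Matrix ι ι ℝ}
    (hΛ₀ : Λ₀.PosSemidef) (hΛ₁ : Λ₁.PosSemidef) (hdΛ₀ : Λ₀.det ≠ 0) (hdΛ₁ : Λ₁.det ≠ 0)
    (h : ∀ z : ℂ, ‖z‖ = 1 →
      evalMatrix z F₀ * Λ₀.map (algebraMap ℝ ℂ) * (evalMatrix z F₀)ᴴ =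
      evalMatrix z F₁ * Λ₁.map (algebraMap ℝ ℂ) * (evalMatrix z F₁)ᴴ) :
    ∃ U : Matrix ι ι ℝ, F₀ = F₁ * U.map RatFunc.C ∧ U * Λ₀ * Uᵀ = Λ₁ := by
  obtain ⟨B₀, rfl, hB₀⟩ := exists_mul_transpose_of_posSemidef hΛ₀ hdΛ₀
  obtain ⟨B₁, rfl, hB₁⟩ := exists_mul_transpose_of_posSemidef hΛ₁ hdΛ₁
  have hev : ∀ (F : Matrix ι ι (RatFunc ℝ)) (B : Matrix ι ι ℝ) (z : ℂ), 1 ≤ ‖z‖ →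
      (∀ z : ℂ, 1 ≤ ‖z‖ → ∀ i k, F i k ∈ regularAt z) →
      evalMatrix z (F * B.map RatFunc.C) * (evalMatrix z (F * B.map RatFunc.C))ᴴ =
        evalMatrix z F * (B * Bᵀ).map (algebraMap ℝ ℂ) * (evalMatrix z F)ᴴ := by
    intro F B z hz hF
    have h1 : (B.map (algebraMap ℝ ℂ))ᴴ = Bᵀ.map (algebraMap ℝ ℂ) := by
      ext i k
      simp [Matrix.conjTranspose_apply]
    rw [evalMatrix_mul (hF z hz) (map_C_mem_regularAt B z), evalMatrix_map_C,
      Matrix.conjTranspose_mul, Matrix.map_mul, h1]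
    simp only [Matrix.mul_assoc]
  have hreg : ∀ (F : Matrix ι ι (RatFunc ℝ)) (B : Matrix ι ι ℝ),
      (∀ z : ℂ, 1 ≤ ‖z‖ → ∀ i k, F i k ∈ regularAt z) →
      ∀ z : ℂ, 1 ≤ ‖z‖ → ∀ i k, (F * B.map RatFunc.C) i k ∈ regularAt z :=
    fun F B hF z hz => mul_mem_regularAt (hF z hz) (map_C_mem_regularAt B z)
  have hinv : ∀ (F : Matrix ι ι (RatFunc ℝ)) (B : Matrix ι ι ℝ), B.det ≠ 0 →
      (∀ z : ℂ, 1 < ‖z‖ → ∀ i k, F⁻¹ i k ∈ regularAt z) →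
      ∀ z : ℂ, 1 < ‖z‖ → ∀ i k, (F * B.map RatFunc.C)⁻¹ i k ∈ regularAt z := by
    intro F B hB hF z hz
    rw [Matrix.mul_inv_rev, inv_map_C hB]
    exact mul_mem_regularAt (map_C_mem_regularAt _ z) (hF z hz)
  have hval : ∀ B : Matrix ι ι ℝ, ∀ i k,
      HasValueAtInfinity ((B.map RatFunc.C : Matrix ι ι (RatFunc ℝ)) i k) (B i k) :=
    fun B i k => HasValueAtInfinity.C _
  -- Absorbing the factors `Λ = B * Bᵀ` into `F₀` and `F₁` reduces to unit covariance; undoing it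
  -- turns the orthogonal `O` into `B₁ * O * B₀⁻¹`.
  obtain ⟨O, hO, hO1⟩ := exists_orthogonal_of_eq_on_circle (hreg F₀ B₀ hF₀) (hreg F₁ B₁ hF₁)
    (hinv F₀ B₀ hB₀ hI₀) (hinv F₁ B₁ hB₁ hI₁)
    (HasValueAtInfinity.matrix_mul hA₀ (hval B₀)) (HasValueAtInfinity.matrix_mul hA₁ (hval B₁))
    (by rw [Matrix.det_mul]; exact mul_ne_zero hd₀ hB₀)
    (by rw [Matrix.det_mul]; exact mul_ne_zero hd₁ hB₁)
    (fun z hz => by rw [hev _ _ z hz.ge hF₀, hev _ _ z hz.ge hF₁, h z hz])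
  have hc : B₀⁻¹ * B₀ = 1 := Matrix.nonsing_inv_mul _ hB₀.isUnit
  have hc' : B₀ * B₀⁻¹ = 1 := Matrix.mul_nonsing_inv _ hB₀.isUnit
  refine ⟨B₁ * O * B₀⁻¹, ?_, ?_⟩
  · rw [Matrix.map_mul, Matrix.map_mul, ← Matrix.mul_assoc, ← Matrix.mul_assoc, ← hO,
      Matrix.mul_assoc, ← Matrix.map_mul, hc', Matrix.map_one _ (map_zero _) (map_one _),
      Matrix.mul_one]
  · have h1 : B₁ * O * B₀⁻¹ * (B₀ * B₀ᵀ) * (B₁ * O * B₀⁻¹)ᵀ =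
        B₁ * O * (B₀⁻¹ * B₀) * (B₀⁻¹ * B₀)ᵀ * Oᵀ * B₁ᵀ := by
      simp only [Matrix.transpose_mul, Matrix.mul_assoc]
    rw [h1, hc, Matrix.transpose_one, Matrix.mul_one, Matrix.mul_one, Matrix.mul_assoc B₁, hO1,
      Matrix.mul_one]

/-- `A` is lower triangular with unit diagonal with respect to the order given by `σ`. -/
def IsUnitLowerTriangular {ι α : Type*} [LinearOrder α] (σ : ι → α) (A : Matrix ι ι ℝ) : Prop :=
  (∀ i k, σ i < σ k → A i k = 0) ∧ ∀ i, A i i = 1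

variable {α : Type*} [LinearOrder α] {σ : ι → α}

/-- Forward substitution: row `i` of `A * U = B` gives `U i k` from the rows preceding `i`. The
induction is on the number of those rows. -/
theorem IsUnitLowerTriangular.of_mul_eq {ι : Type*} [Fintype ι] {σ : ι → α}
    (hσ : Function.Injective σ) {A U B : Matrix ι ι ℝ}
    (hA : IsUnitLowerTriangular σ A) (hB : IsUnitLowerTriangular σ B) (h : A * U = B) :
    IsUnitLowerTriangular σ U := by
  have hlow : ∀ k i, σ i < σ k → U i k = 0 := by
    intro k i
    induction hi : Finset.card (Finset.univ.filter fun l => σ l < σ i) using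
      Nat.strong_induction_on generalizing i with
    | _ n ih =>
    intro hik
    have h1 := congrFun (congrFun h i) k
    rw [Matrix.mul_apply, hB.1 i k hik, Finset.sum_eq_single i, hA.2, one_mul] at h1
    · exact h1
    · intro l _ hl
      rcases lt_or_gt_of_ne (hσ.ne hl) with hli | hli
      · rw [ih _ ?_ l rfl (hli.trans hik), mul_zero]
        rw [← hi]
        refine Finset.card_lt_card ⟨fun x hx => ?_, fun hsub => ?_⟩
        · simp only [Finset.mem_filter, Finset.mem_univ, true_and] at hx ⊢
          exact hx.trans hli
        · have := hsub (Finset.mem_filter.2 ⟨Finset.mem_univ l, hli⟩)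
          simp at this
      · rw [hA.1 i l hli, zero_mul]
    · simp
  refine ⟨fun i k => hlow k i, fun i => ?_⟩
  have h1 := congrFun (congrFun h i) i
  rwa [Matrix.mul_apply, hB.2, Finset.sum_eq_single i, hA.2, one_mul] at h1
  · intro l _ hl
    rcases lt_or_gt_of_ne (hσ.ne hl) with hli | hli
    · rw [hlow i l hli, mul_zero]
    · rw [hA.1 i l hli, zero_mul]
  · simp

theorem IsUnitLowerTriangular.det_eq_one (hσ : Function.Injective σ) {A : Matrix ι ι ℝ}
    (hA : IsUnitLowerTriangular σ A) : A.det = 1 := by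
  let lin : LinearOrder ι := LinearOrder.lift' σ hσ
  rw [Matrix.det_of_isLowerTriangular A fun i k hik => hA.1 i k hik]
  exact Finset.prod_eq_one fun i _ => hA.2 i

/-- A unit lower triangular congruence between nonsingular diagonal matrices is trivial. -/
theorem IsUnitLowerTriangular.eq_one (hσ : Function.Injective σ) {U D₀ D₁ : Matrix ι ι ℝ}
    (hU : IsUnitLowerTriangular σ U) (hD₀ : D₀.IsDiag) (hD₁ : D₁.IsDiag) (hd : D₀.det ≠ 0)
    (h : U * D₀ * Uᵀ = D₁) : U = 1 := by
  have hentry : ∀ i k, (U * D₀ * Uᵀ) i k = ∑ l, U i l * D₀ l l * U k l := by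
    intro i k
    rw [Matrix.mul_apply]
    refine Finset.sum_congr rfl fun l _ => ?_
    rw [Matrix.mul_apply, Finset.sum_eq_single l, Matrix.transpose_apply]
    · intro m _ hm
      rw [hD₀ hm, mul_zero]
    · simp
  have hD₀ne : ∀ i, D₀ i i ≠ 0 := by
    intro i h0
    refine hd (Matrix.det_eq_zero_of_row_eq_zero i fun k => ?_)
    by_cases hik : i = k
    · rw [← hik, h0]
    · exact hD₀ hik
  -- Induct on columns: in entry `(i, k)` of `U * D₀ * Uᵀ`, earlier columns vanish by induction and
  -- later ones by triangularity. Only `U i k * D₀ k k` survives, and it is zero because `D₁` is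
  -- diagonal.
  have hoff : ∀ k i, σ k < σ i → U i k = 0 := by
    intro k
    induction hk : Finset.card (Finset.univ.filter fun l => σ l < σ k) using
      Nat.strong_induction_on generalizing k with
    | _ n ih =>
    intro i hik
    have h1 := hentry i k
    rw [h, hD₁ (fun he => hik.ne (congrArg σ he.symm)), Finset.sum_eq_single k, hU.2, mul_one]
      at h1
    · exact (mul_eq_zero.1 h1.symm).resolve_right (hD₀ne k)
    · intro l _ hl
      rcases lt_or_gt_of_ne (hσ.ne hl) with hlk | hlk
      · rw [ih _ ?_ l rfl k hlk, mul_zero]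
        rw [← hk]
        refine Finset.card_lt_card ⟨fun x hx => ?_, fun hsub => ?_⟩
        · simp only [Finset.mem_filter, Finset.mem_univ, true_and] at hx ⊢
          exact hx.trans hlk
        · have := hsub (Finset.mem_filter.2 ⟨Finset.mem_univ l, hlk⟩)
          simp at this
      · rw [hU.1 k l hlk, mul_zero]
    · simp
  ext i k
  by_cases hik : i = k
  · rw [← hik, hU.2, Matrix.one_apply_eq]
  · rw [Matrix.one_apply_ne hik]
    rcases lt_or_gt_of_ne (hσ.ne hik) with h1 | h1
    · exact hU.1 i k h1
    · exact hoff k i h1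

end SpectralFactorization

/-! ### From the measured spectrum to the noise transfer matrix -/

namespace ModelSet

variable {W K : Type*} [Fintype W] [DecidableEq W] {M : ModelSet W K}

theorem IsNetworkModelSet.hasValueAtInfinity_one_sub_G (hM : M.IsNetworkModelSet)
    {θ : Fin M.n → ℝ} (hθ : θ ∈ M.Θ) (i k : W) :
    HasValueAtInfinity ((1 - M.G θ) i k) ((1 - M.Ginf θ) i k) :=
  (HasValueAtInfinity.matrix_one i k).sub (hM.G_proper θ hθ i k).hasValueAtInfinity

theorem IsNetworkModelSet.det_one_sub_Ginf_ne_zero (hM : M.IsNetworkModelSet)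
    {θ : Fin M.n → ℝ} (hθ : θ ∈ M.Θ) : (1 - M.Ginf θ).det ≠ 0 := by
  have h := hM.wellPosed θ hθ Finset.univ
  rwa [← Matrix.det_submatrix_equiv_self (Equiv.subtypeUnivEquiv Finset.mem_univ)]

theorem IsNetworkModelSet.det_one_sub_G_ne_zero (hM : M.IsNetworkModelSet)
    {θ : Fin M.n → ℝ} (hθ : θ ∈ M.Θ) : (1 - M.G θ).det ≠ 0 :=
  HasValueAtInfinity.det_ne_zero (hM.hasValueAtInfinity_one_sub_G hθ)
    (hM.det_one_sub_Ginf_ne_zero hθ)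

/-- Since `H̃` is monic, `[H̃; 0]` has the value `[I; 0]` at infinity, which selects the measured
columns of `(1 - Ginf)⁻¹`. -/
theorem IsNetworkModelSet.hasValueAtInfinity_noiseTransfer (hM : M.IsNetworkModelSet)
    {θ : Fin M.n → ℝ} (hθ : θ ∈ M.Θ) (i k : M.C) :
    HasValueAtInfinity (M.noiseTransfer θ i k)
      (((1 - M.Ginf θ)⁻¹).submatrix (fun i : M.C => (i : W)) (fun i : M.C => (i : W)) i k) := by
  let J : Matrix W M.C ℝ := Matrix.of fun i k => if i = k then 1 else 0
  have hJ : ∀ i k, HasValueAtInfinity (M.Hp θ i k) (J i k) := by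
    intro i k
    by_cases hi : i ∈ M.C
    · have h1 : M.Hp θ i k = M.H θ ⟨i, hi⟩ k := by simp [Hp, hi]
      have h2 : J i k = atInfinity (M.H θ ⟨i, hi⟩ k) := by
        have := congrFun (congrFun (hM.H_monic θ hθ) ⟨i, hi⟩) k
        rw [Matrix.map_apply] at this
        rw [this]
        simp [J, Matrix.one_apply, Subtype.ext_iff]
      rw [h1, h2]
      exact (hM.H_proper θ hθ _ _).hasValueAtInfinity
    · have h1 : M.Hp θ i k = 0 := by simp [Hp, hi]
      have h2 : J i k = 0 := by
        have : i ≠ k := by rintro rfl; exact hi k.2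
        simp [J, this]
      rw [h1, h2]
      exact HasValueAtInfinity.zero
  have h := HasValueAtInfinity.matrix_mul (HasValueAtInfinity.matrix_inv
    (hM.hasValueAtInfinity_one_sub_G hθ) (hM.det_one_sub_Ginf_ne_zero hθ)) hJ (i : W) k
  have h3 : ((1 - M.Ginf θ)⁻¹ * J) i k = (1 - M.Ginf θ)⁻¹ i k := by
    simp [Matrix.mul_apply, J]
  rw [h3] at h
  exact h

theorem IsNetworkModelSet.G_mem_regularAt (hM : M.IsNetworkModelSet)
    {θ : Fin M.n → ℝ} (hθ : θ ∈ M.Θ) {z : ℂ} (hz : 1 ≤ ‖z‖) (i k : W) :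
    M.G θ i k ∈ regularAt z := fun h => (hM.G_stable θ hθ i k z h).not_ge hz

theorem IsNetworkModelSet.T_mem_regularAt (hM : M.IsNetworkModelSet)
    {θ : Fin M.n → ℝ} (hθ : θ ∈ M.Θ) {z : ℂ} (hz : 1 ≤ ‖z‖) (i k : W) :
    M.T θ i k ∈ regularAt z := fun h => (hM.T_stable θ hθ i k z h).not_ge hz

theorem IsNetworkModelSet.Hp_mem_regularAt (hM : M.IsNetworkModelSet)
    {θ : Fin M.n → ℝ} (hθ : θ ∈ M.Θ) {z : ℂ} (hz : 1 ≤ ‖z‖) (i : W) (k : M.C) :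
    M.Hp θ i k ∈ regularAt z := by
  by_cases hi : i ∈ M.C
  · have h1 : M.Hp θ i k = M.H θ ⟨i, hi⟩ k := by simp [Hp, hi]
    rw [h1]
    exact fun h => (hM.H_stable θ hθ _ _ z h).not_ge hz
  · have h1 : M.Hp θ i k = 0 := by simp [Hp, hi]
    rw [h1]
    exact Subring.zero_mem _

theorem IsNetworkModelSet.noiseTransfer_mem_regularAt (hM : M.IsNetworkModelSet)
    {θ : Fin M.n → ℝ} (hθ : θ ∈ M.Θ) (z : ℂ) (hz : 1 ≤ ‖z‖) (i k : M.C) :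
    M.noiseTransfer θ i k ∈ regularAt z :=
  mul_mem_regularAt (hM.T_mem_regularAt hθ hz) (hM.Hp_mem_regularAt hθ hz) (i : W) k

/-- The spectrum is defined by inverting after evaluation at `e^{iω}`. Stability excludes poles on
the circle, so evaluation is multiplicative there and commutes with the inverse. -/
theorem IsNetworkModelSet.measuredSpectrum_eq (hM : M.IsNetworkModelSet)
    {θ : Fin M.n → ℝ} (hθ : θ ∈ M.Θ) (ω : ℝ) :
    M.measuredSpectrum θ ω = evalMatrix (Complex.exp (Complex.I * ω)) (M.noiseTransfer θ) *
      (M.Λ θ).map (algebraMap ℝ ℂ) *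
      (evalMatrix (Complex.exp (Complex.I * ω)) (M.noiseTransfer θ))ᴴ := by
  set z := Complex.exp (Complex.I * ω)
  have hz : 1 ≤ ‖z‖ := by
    have : ‖z‖ = 1 := by
      change ‖Complex.exp (Complex.I * ω)‖ = 1
      rw [mul_comm, Complex.norm_exp_ofReal_mul_I]
    exact this.ge
  have hG := hM.G_mem_regularAt hθ hz
  have hT := hM.T_mem_regularAt hθ hz
  have h1 : (1 - M.G θ) * M.T θ = 1 :=
    Matrix.mul_nonsing_inv _ (hM.det_one_sub_G_ne_zero hθ).isUnit
  have h2 : evalMatrix z (M.T θ) - evalMatrix z (M.G θ) * evalMatrix z (M.T θ) = 1 := by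
    have h3 : M.T θ = 1 + M.G θ * M.T θ := by
      rw [← h1, Matrix.sub_mul, Matrix.one_mul, sub_add_cancel]
    have h4 : ∀ i k, (1 : Matrix W W (RatFunc ℝ)) i k ∈ regularAt z := by
      intro i k
      by_cases hik : i = k
      · rw [hik, Matrix.one_apply_eq]; exact Subring.one_mem _
      · rw [Matrix.one_apply_ne hik]; exact Subring.zero_mem _
    have h5 : evalMatrix z (1 + M.G θ * M.T θ) =
        evalMatrix z (1 : Matrix W W (RatFunc ℝ)) + evalMatrix z (M.G θ * M.T θ) := by
      ext i k
      exact RatFunc.eval_add _ _ (h4 i k) (mul_mem_regularAt hG hT i k)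
    have h6 := congrArg (evalMatrix z) h3
    rw [h5, evalMatrix_one, evalMatrix_mul hG hT] at h6
    rw [sub_eq_iff_eq_add]
    exact h6
  have h7 : (1 - freqResponse (M.G θ) ω)⁻¹ = evalMatrix z (M.T θ) := by
    refine Matrix.inv_eq_right_inv ?_
    rw [Matrix.sub_mul, Matrix.one_mul]
    exact h2
  have h8 : M.spectrum θ ω = evalMatrix z (M.T θ * M.Hp θ) * (M.Λ θ).map (algebraMap ℝ ℂ) *
      (evalMatrix z (M.T θ * M.Hp θ))ᴴ := by
    rw [evalMatrix_mul hT (hM.Hp_mem_regularAt hθ hz), Matrix.conjTranspose_mul, spectrum, h7,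
      ← Matrix.mul_assoc]
    rfl
  rw [measuredSpectrum, h8]
  rfl

/-- One frequency of full rank suffices: `det Λ` is a factor of the determinant of the spectrum
there. -/
theorem IsNetworkModelSet.det_Λ_ne_zero (hM : M.IsNetworkModelSet) (hRank : M.HasFullRankSpectrum)
    {θ : Fin M.n → ℝ} (hθ : θ ∈ M.Θ) : (M.Λ θ).det ≠ 0 := by
  obtain ⟨ω, hω⟩ := (hRank θ hθ).exists
  have h := det_ne_zero_of_rank_eq _ (hω.trans (Fintype.card_coe M.C).symm)
  rw [hM.measuredSpectrum_eq hθ, Matrix.det_mul, Matrix.det_mul] at h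
  intro h0
  apply h
  have : ((M.Λ θ).map (algebraMap ℝ ℂ)).det = 0 := by
    rw [← RingHom.mapMatrix_apply, ← RingHom.map_det, h0, map_zero]
  rw [this, mul_zero, zero_mul]

theorem Ginf_eq_zero_of_strictlyProper {W K : Type*} {M : ModelSet W K} {θ : Fin M.n → ℝ}
    (h : ∀ i k, IsStrictlyProper (M.G θ i k)) : M.Ginf θ = 0 := by
  ext i k
  refine Polynomial.coeff_eq_zero_of_degree_lt ?_
  rw [← Polynomial.degree_eq_natDegree (RatFunc.denom_ne_zero _)]
  exact h i k

/-- The spectrum of the measured signals determines the transfer matrix of the noise. -/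
theorem IsNetworkModelSet.noiseTransfer_eq (hM : M.IsNetworkModelSet)
    (hRank : M.HasFullRankSpectrum) (hFeed : M.FeedthroughCondition)
    (hMinPhase : ∀ θ ∈ M.Θ, IsMinimumPhase (M.noiseTransfer θ))
    {θ₀ θ₁ : Fin M.n → ℝ} (hθ₀ : θ₀ ∈ M.Θ) (hθ₁ : θ₁ ∈ M.Θ)
    (h : ∀ ω : ℝ, M.measuredSpectrum θ₀ ω = M.measuredSpectrum θ₁ ω) :
    M.noiseTransfer θ₀ = M.noiseTransfer θ₁ := by
  -- In the strictly proper case `Ginf = 0` and any ordering works, so both cases share the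
  -- triangular argument at infinity.
  obtain ⟨σ, hσ⟩ : ∃ σ : W ≃ Fin (Fintype.card W), ∀ θ ∈ M.Θ, ∀ i k, σ i < σ k →
      M.Ginf θ i k = 0 := by
    rcases hFeed with hs | ⟨-, σ, hσ⟩
    · refine ⟨Fintype.equivFin W, fun θ hθ i k _ => ?_⟩
      rw [Ginf_eq_zero_of_strictlyProper (hs θ hθ)]
      rfl
    · exact ⟨σ, hσ⟩
  let val : (Fin M.n → ℝ) → Matrix M.C M.C ℝ := fun θ =>
    ((1 - M.Ginf θ)⁻¹).submatrix (fun i : M.C => (i : W)) (fun i : M.C => (i : W))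
  let τ : M.C → Fin (Fintype.card W) := fun i => σ i
  have hτ : Function.Injective τ := fun i k hik => Subtype.ext (σ.injective hik)
  have hval : ∀ θ ∈ M.Θ, IsUnitLowerTriangular τ (val θ) := by
    intro θ hθ
    have h1 : IsUnitLowerTriangular σ (1 - M.Ginf θ) := by
      refine ⟨fun i k hik => ?_, fun i => ?_⟩
      · rw [Matrix.sub_apply, hσ θ hθ i k hik, Matrix.one_apply_ne (fun he => hik.ne (congrArg σ he)),
          sub_zero]
      · rw [Matrix.sub_apply, Matrix.one_apply_eq, Ginf, Matrix.map_apply, hM.G_hollow θ hθ i]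
        simp [atInfinity]
    have h2 : IsUnitLowerTriangular σ (1 : Matrix W W ℝ) :=
      ⟨fun i k hik => Matrix.one_apply_ne (fun he => hik.ne (congrArg σ he)),
        fun i => Matrix.one_apply_eq i⟩
    have h3 := IsUnitLowerTriangular.of_mul_eq σ.injective h1 h2
      (Matrix.mul_nonsing_inv _ (hM.det_one_sub_Ginf_ne_zero hθ).isUnit)
    exact ⟨fun i k hik => h3.1 i k hik, fun i => h3.2 i⟩
  have hdet : ∀ θ ∈ M.Θ, (val θ).det ≠ 0 := by
    intro θ hθ
    rw [(hval θ hθ).det_eq_one hτ]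
    exact one_ne_zero
  have hinv : ∀ θ ∈ M.Θ, ∀ z : ℂ, 1 < ‖z‖ → ∀ i k, (M.noiseTransfer θ)⁻¹ i k ∈ regularAt z :=
    fun θ hθ z hz i k hp => ((hMinPhase θ hθ).2 i k z hp).not_gt hz
  obtain ⟨U, hU, hUΛ⟩ := exists_constant_of_spectrum_eq
    (hM.noiseTransfer_mem_regularAt hθ₀) (hM.noiseTransfer_mem_regularAt hθ₁)
    (hinv θ₀ hθ₀) (hinv θ₁ hθ₁) (hM.hasValueAtInfinity_noiseTransfer hθ₀)
    (hM.hasValueAtInfinity_noiseTransfer hθ₁) (hdet θ₀ hθ₀) (hdet θ₁ hθ₁)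
    (hM.Λ_posSemidef θ₀ hθ₀) (hM.Λ_posSemidef θ₁ hθ₁) (hM.det_Λ_ne_zero hRank hθ₀)
    (hM.det_Λ_ne_zero hRank hθ₁) (fun z hz => by
      have h1 : Complex.exp (Complex.I * (z.arg : ℂ)) = z := by
        have := Complex.norm_mul_exp_arg_mul_I z
        rwa [hz, Complex.ofReal_one, one_mul, mul_comm] at this
      have h2 := h z.arg
      rwa [hM.measuredSpectrum_eq hθ₀, hM.measuredSpectrum_eq hθ₁, h1] at h2)
  have hvalU : val θ₁ * U = val θ₀ := by
    ext i k
    have h1 := HasValueAtInfinity.matrix_mul (hM.hasValueAtInfinity_noiseTransfer hθ₁)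
      (B := U.map RatFunc.C) (b := U) (fun i k => HasValueAtInfinity.C _) i k
    rw [← hU] at h1
    exact h1.unique (hM.hasValueAtInfinity_noiseTransfer hθ₀ i k)
  -- Under strict properness both values at infinity are the identity. Otherwise `U` is unit lower
  -- triangular and a congruence between nonsingular diagonal covariances.
  have hU1 : U = 1 := by
    rcases hFeed with hs | ⟨hd, -⟩
    · have hone : ∀ θ ∈ M.Θ, val θ = 1 := by
        intro θ hθ
        simp only [val]
        rw [Ginf_eq_zero_of_strictlyProper (hs θ hθ), sub_zero, inv_one]
        exact Matrix.submatrix_one _ Subtype.val_injective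
      rwa [hone θ₀ hθ₀, hone θ₁ hθ₁, Matrix.one_mul] at hvalU
    · exact (IsUnitLowerTriangular.of_mul_eq hτ (hval θ₁ hθ₁) (hval θ₀ hθ₀) hvalU).eq_one hτ
        (hd θ₀ hθ₀) (hd θ₁ hθ₁) (hM.det_Λ_ne_zero hRank hθ₀) hUΛ
  rw [hU, hU1, Matrix.map_one _ (map_zero _) (map_one _), Matrix.mul_one]

end ModelSet
end DynNet

/-! ### Ranks of transfer vectors and path counts -/

namespace DynNet

section LinearAlgebra

variable {F V ι : Type*} [Field F] [AddCommGroup V] [Module F V]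

theorem exists_linearIndependent_of_finrank [Finite ι] (v : ι → V) (S : Set ι) {r : ℕ}
    (hr : Module.finrank F (Submodule.span F (v '' S)) = r) :
    ∃ w : Fin r → ι, (∀ a, w a ∈ S) ∧ LinearIndependent F (v ∘ w) := by
  obtain ⟨B, hBS, hspan, hli⟩ := exists_linearIndependent F (v '' S)
  have hfin : B.Finite := (Set.toFinite (v '' S)).subset hBS
  have : Fintype B := hfin.fintype
  have hcard : Fintype.card B = r := by
    rw [← hr, ← hspan, ← finrank_span_eq_card hli, Subtype.range_coe]
  let e : Fin r ≃ B := (finCongr hcard.symm).trans (Fintype.equivFin B).symm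
  choose w hwS hw using fun a => hBS (e a).2
  refine ⟨w, hwS, ?_⟩
  have : v ∘ w = (Subtype.val : B → V) ∘ e := funext hw
  rw [this]
  exact hli.comp e e.injective

/-- A family of vectors of rank `r` has a nonsingular submatrix of size `r`. -/
theorem exists_det_ne_zero_of_finrank {κ : Type*} [Finite ι] [Finite κ] (v : ι → κ → F)
    (S : Set ι) {r : ℕ} (hr : Module.finrank F (Submodule.span F (v '' S)) = r) :
    ∃ (w : Fin r ↪ ι) (x : Fin r ↪ κ), (∀ a, w a ∈ S) ∧
      ((Matrix.of v).submatrix w x).det ≠ 0 := by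
  classical
  have : Fintype κ := Fintype.ofFinite κ
  obtain ⟨w, hwS, hw⟩ := exists_linearIndependent_of_finrank v S hr
  let N : Matrix (Fin r) κ F := (Matrix.of v).submatrix w id
  have hN : N.rank = r := by
    rw [LinearIndependent.rank_matrix (M := N) hw, Fintype.card_fin]
  rw [Matrix.rank_eq_finrank_span_cols, ← Set.image_univ] at hN
  obtain ⟨x, -, hx⟩ := exists_linearIndependent_of_finrank N.col Set.univ hN
  refine ⟨⟨w, hw.injective.of_comp⟩, ⟨x, hx.injective.of_comp⟩, hwS, ?_⟩
  have h1 : LinearIndependent F ((Matrix.of v).submatrix w x).col := hx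
  rw [Matrix.linearIndependent_cols_iff_isUnit, Matrix.isUnit_iff_isUnit_det] at h1
  exact h1.ne_zero

/-- Restricting vectors to the coordinates `x` is linear, so independence of the restricted rows
lifts to the full vectors. -/
theorem le_finrank_of_det_ne_zero {κ : Type*} [Finite κ] (v : ι → κ → F)
    (S : Set ι) {r : ℕ} (w : Fin r → ι) (x : Fin r → κ) (hw : ∀ a, w a ∈ S)
    (h : ((Matrix.of v).submatrix w x).det ≠ 0) :
    r ≤ Module.finrank F (Submodule.span F (v '' S)) := by
  have h1 : LinearIndependent F ((Matrix.of v).submatrix w x).row := by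
    rw [Matrix.linearIndependent_rows_iff_isUnit, Matrix.isUnit_iff_isUnit_det]
    exact h.isUnit
  have h2 : LinearIndependent F (v ∘ w) :=
    LinearIndependent.of_comp (LinearMap.funLeft F F x) h1
  have h3 := finrank_span_eq_card h2
  rw [Fintype.card_fin] at h3
  calc r = _ := h3.symm
    _ ≤ _ := Submodule.finrank_mono (Submodule.span_mono (by
      rintro _ ⟨a, rfl⟩
      exact ⟨w a, hw a, rfl⟩))

/-- If adjoining the vectors `v i`, `i ∈ N`, increases the dimension of `A` by `|N|`, then these
vectors are linearly independent modulo `A`. -/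
theorem coeff_eq_zero_of_finrank_sup [FiniteDimensional F V] (v : ι → V) (N : Set ι)
    [Fintype N] (A : Submodule F V) {p : ℕ} (hA : Module.finrank F A ≤ p)
    (hAN : p + Fintype.card N ≤ Module.finrank F ↥(A ⊔ Submodule.span F (v '' N)))
    (d : N → F) (hd : ∑ i : N, d i • v i ∈ A) (i : N) : d i = 0 := by
  set B := Submodule.span F (v '' N) with hB
  have hBr : B = Submodule.span F (Set.range fun i : N => v i) := by
    rw [hB, Set.image_eq_range]
  have hBle : Module.finrank F B ≤ Fintype.card N := by
    rw [hBr]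
    exact finrank_range_le_card _
  have hsum := Submodule.finrank_sup_add_finrank_inf_eq A B
  -- The dimension formula is tight: `dim A ≤ p` and `dim B ≤ |N|`, while the sum has dimension at
  -- least `p + |N|`.
  have hinf : A ⊓ B = ⊥ := Submodule.finrank_eq_zero.1 (by omega)
  have hli : LinearIndependent F fun i : N => v i := by
    rw [linearIndependent_iff_card_eq_finrank_span]
    change _ = Module.finrank F (Submodule.span F (Set.range fun i : N => v i))
    rw [← hBr]
    omega
  have hmem : ∑ i : N, d i • v i ∈ B :=
    Submodule.sum_mem _ fun i _ => Submodule.smul_mem _ _ (Submodule.subset_span ⟨i, i.2, rfl⟩)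
  have hz : ∑ i : N, d i • v i ∈ A ⊓ B := ⟨hd, hmem⟩
  rw [hinf, Submodule.mem_bot] at hz
  exact Fintype.linearIndependent_iff.1 hli d hz i

end LinearAlgebra

namespace ModelSet

theorem finite_ext {W K : Type*} [Finite W] (M : ModelSet W K) : Finite M.Ext :=
  have : Finite K := Finite.of_injective M.exc M.exc.injective
  inferInstance

variable {W K : Type*} [Fintype W] [DecidableEq W] (M : ModelSet W K)

/-- The transfer vector from the external signals in `Xbar` to an internal signal. -/
noncomputable def transferRow (Xbar : Set M.Ext) (θ : Fin M.n → ℝ) (i : W) : Xbar → RatFunc ℝ :=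
  fun x => (M.T θ * M.X θ) i x

/-- The space spanned by the transfer vectors to the internal signals in `Wbar`. -/
noncomputable def transferSpan (Xbar : Set M.Ext) (Wbar : Set W) (θ : Fin M.n → ℝ) :
    Submodule (RatFunc ℝ) (Xbar → RatFunc ℝ) :=
  Submodule.span (RatFunc ℝ) (M.transferRow Xbar θ '' Wbar)

theorem transferSpan_mono (Xbar : Set M.Ext) {W₁ W₂ : Set W} (h : W₁ ⊆ W₂) (θ : Fin M.n → ℝ) :
    M.transferSpan Xbar W₁ θ ≤ M.transferSpan Xbar W₂ θ :=
  Submodule.span_mono (Set.image_mono h)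

variable {M}

/-- The rank of the transfer matrix is at most the maximum number of vertex disjoint paths. -/
theorem finrank_transferSpan_le_b {θ : Fin M.n → ℝ} (hθ : θ ∈ M.Θ) (hdet : (1 - M.G θ).det ≠ 0)
    (Xbar : Set M.Ext) (Wbar : Set W) :
    Module.finrank (RatFunc ℝ) (M.transferSpan Xbar Wbar θ) ≤ M.b Xbar Wbar := by
  have := M.finite_ext
  obtain ⟨w, x, hw, h⟩ := exists_det_ne_zero_of_finrank (M.transferRow Xbar θ) Wbar rfl
  exact M.le_b_of_det_ne_zero hθ hdet w (x.trans (Function.Embedding.subtype _)) Xbar Wbar hw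
    (fun a => (x a).2) h

/-- Generically, the rank of the transfer matrix is at least the maximum number of vertex disjoint
paths. -/
theorem ae_b_le_finrank_transferSpan (hIndep : M.IsIndependentlyParameterized)
    (hFixed : M.FixedSubmatricesHaveStructuralRank)
    (hhollow : ∀ θ ∈ M.Θ, ∀ i, M.G θ i i = 0) (hdet : ∀ θ ∈ M.Θ, (1 - M.G θ).det ≠ 0)
    (Xbar : Set M.Ext) (Wbar : Set W) :
    ∀ᵐ θ, θ ∈ M.Θ → M.b Xbar Wbar ≤ Module.finrank (RatFunc ℝ) (M.transferSpan Xbar Wbar θ) := by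
  have := M.finite_ext
  obtain ⟨w, x, hw, hx, h⟩ := M.ae_exists_det_ne_zero hIndep hFixed hhollow hdet Xbar Wbar
  filter_upwards [h] with θ hθ hθΘ
  exact le_finrank_of_det_ne_zero (M.transferRow Xbar θ) Wbar w (fun a => ⟨x a, hx a⟩) hw (hθ hθΘ)

/-- The equation of the internal signal `w_j`. -/
theorem transferRow_sub_sum {θ : Fin M.n → ℝ} (hdet : (1 - M.G θ).det ≠ 0) (Xbar : Set M.Ext)
    (j : W) (x : Xbar) :
    M.transferRow Xbar θ j x - ∑ i, M.G θ j i * M.transferRow Xbar θ i x = M.X θ j x := by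
  have h1 : (1 - M.G θ) * (M.T θ * M.X θ) = M.X θ := by
    rw [← Matrix.mul_assoc, T, Matrix.mul_nonsing_inv _ hdet.isUnit, Matrix.one_mul]
  have h2 := congrFun (congrFun h1 j) x
  rw [Matrix.sub_mul, Matrix.one_mul, Matrix.sub_apply, Matrix.mul_apply] at h2
  exact h2

theorem transferRow_eq_of_measured {θ₀ θ₁ : Fin M.n → ℝ} (hCTR : M.CTR θ₀ = M.CTR θ₁)
    (hN : M.noiseTransfer θ₀ = M.noiseTransfer θ₁) (Xbar : Set M.Ext) {i : W} (hi : i ∈ M.C) :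
    M.transferRow Xbar θ₀ i = M.transferRow Xbar θ₁ i := by
  ext ⟨x, hx⟩
  rcases x with p | k
  · have := congrFun (congrFun hCTR ⟨i, hi⟩) p
    simp only [transferRow, X, Matrix.mul_fromCols, Matrix.fromCols_apply_inl]
    exact this
  · have := congrFun (congrFun hN ⟨i, hi⟩) k
    simp only [transferRow, X, Matrix.mul_fromCols, Matrix.fromCols_apply_inr]
    exact this

end ModelSet

end DynNet

/-! ### The identifiability theorem -/

theorem mainTheorem10 {W K : Type*} [Fintype W] [DecidableEq W] (M : DynNet.ModelSet W K)
    (hM : M.IsNetworkModelSet)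
    (hRank : M.HasFullRankSpectrum)
    (hIndep : M.IsIndependentlyParameterized)
    (hFeed : M.FeedthroughCondition)
    (hFixed : M.FixedSubmatricesHaveStructuralRank)
    (hMinPhase : ∀ θ ∈ M.Θ, DynNet.IsMinimumPhase (M.noiseTransfer θ))
    (j : W) (Nstar : Set W) (hNstar : Nstar ⊆ M.inNeighbors j)
    (Xbar : Set M.Ext) (hXbar : Xbar ⊆ M.excitation j)
    (Cbar : Set W) (hCbar : Cbar ⊆ (M.C : Set W) \ Nstar)
    (hPaths : M.b Xbar (M.inNeighbors j ∪ Cbar) =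
      M.b Xbar ((M.inNeighbors j \ Nstar) ∪ Cbar) + M.b Xbar Nstar)
    (hPathsNstar : M.b Xbar Nstar = Nstar.ncard)
    (hPathsMeasured : M.b Xbar ((M.inNeighbors j \ Nstar) ∪ Cbar) = M.b Xbar Cbar)
    (hNstarMeasured : Nstar ⊆ (M.C : Set W)) (hjMeasured : j ∈ M.C) :
    M.GenericallyIdentifiable j Nstar := by
  classical
  have := M.finite_ext
  have hdet : ∀ θ ∈ M.Θ, (1 - M.G θ).det ≠ 0 := fun θ hθ => hM.det_one_sub_G_ne_zero hθ
  have hb := DynNet.ModelSet.ae_b_le_finrank_transferSpan hIndep hFixed hM.G_hollow hdet Xbar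
  -- Genericity is used only for these two rank lower bounds, both at `θ₀`.
  filter_upwards [hb (M.inNeighbors j ∪ Cbar), hb Cbar] with θ₀ hN hC hθ₀ θ₁ hθ₁ hCTR hΦ
  have hN := hN hθ₀
  have hC := hC hθ₀
  set Y := (M.inNeighbors j \ Nstar) ∪ Cbar with hY
  have hmeas : ∀ i ∈ M.C, M.transferRow Xbar θ₀ i = M.transferRow Xbar θ₁ i := fun i hi =>
    DynNet.ModelSet.transferRow_eq_of_measured hCTR
      (hM.noiseTransfer_eq hRank hFeed hMinPhase hθ₀ hθ₁ hΦ) Xbar hi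
  have hC01 : M.transferSpan Xbar Cbar θ₀ = M.transferSpan Xbar Cbar θ₁ := by
    rw [DynNet.ModelSet.transferSpan, DynNet.ModelSet.transferSpan]
    congr 1
    exact Set.image_congr fun i hi => hmeas i (hCbar hi).1
  have hspan₀ : M.transferSpan Xbar Y θ₀ = M.transferSpan Xbar Cbar θ₀ := by
    refine (Submodule.eq_of_le_of_finrank_le
      (M.transferSpan_mono Xbar Set.subset_union_right θ₀) ?_).symm
    exact (DynNet.ModelSet.finrank_transferSpan_le_b hθ₀ (hdet θ₀ hθ₀) Xbar Y).trans
      (hPathsMeasured.le.trans hC)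
  -- `θ₁` need not be generic: the lower bound for `Cbar` transfers from `θ₀` because measured
  -- vectors coincide, and the upper bound by path counts holds throughout `Θ`.
  have hspan₁ : M.transferSpan Xbar Y θ₁ = M.transferSpan Xbar Cbar θ₀ := by
    rw [hC01] at hC ⊢
    refine (Submodule.eq_of_le_of_finrank_le
      (M.transferSpan_mono Xbar Set.subset_union_right θ₁) ?_).symm
    exact (DynNet.ModelSet.finrank_transferSpan_le_b hθ₁ (hdet θ₁ hθ₁) Xbar Y).trans
      (hPathsMeasured.le.trans hC)
  -- the difference of the equations of `w_j` for the two parameters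
  let t : W → Xbar → RatFunc ℝ := fun i =>
    M.G θ₀ j i • M.transferRow Xbar θ₀ i - M.G θ₁ j i • M.transferRow Xbar θ₁ i
  have ht : ∑ i, t i = 0 := by
    ext x
    have h0 := DynNet.ModelSet.transferRow_sub_sum (hdet θ₀ hθ₀) Xbar j x
    have h1 := DynNet.ModelSet.transferRow_sub_sum (hdet θ₁ hθ₁) Xbar j x
    have hX : M.X θ₀ j x = M.X θ₁ j x := hXbar x.2 θ₀ hθ₀ θ₁ hθ₁
    rw [hX, ← h1, hmeas j hjMeasured, sub_right_inj] at h0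
    simp only [t, Finset.sum_apply, Pi.sub_apply, Pi.smul_apply, smul_eq_mul,
      Finset.sum_sub_distrib, Pi.zero_apply]
    rw [h0, sub_self]
  -- Signals in `Y` contribute vectors of the common span. For the others `t i = 0`: either there is
  -- no edge to `w_j`, or the signal is measured and its edge known.
  have htY : ∀ i, i ∉ Nstar → t i ∈ M.transferSpan Xbar Cbar θ₀ := by
    intro i hi
    by_cases hiN : i ∈ M.inNeighbors j
    · have hiY : i ∈ Y := Or.inl ⟨hiN, hi⟩
      refine Submodule.sub_mem _ (Submodule.smul_mem _ _ ?_) (Submodule.smul_mem _ _ ?_)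
      · rw [← hspan₀]
        exact Submodule.subset_span ⟨i, hiY, rfl⟩
      · rw [← hspan₁]
        exact Submodule.subset_span ⟨i, hiY, rfl⟩
    · have h0 : t i = 0 := by
        by_cases hadj : M.Adj (Sum.inl i) (Sum.inl j)
        · obtain ⟨hiC, hk⟩ : i ∈ M.C ∧ M.IsKnown fun θ => M.G θ j i := by
            by_contra hcon
            exact hiN ⟨hadj, hcon⟩
          simp only [t]
          rw [hmeas i hiC, show M.G θ₀ j i = M.G θ₁ j i from hk θ₀ hθ₀ θ₁ hθ₁, sub_self]
        · have hz : M.IsFixedZero fun θ => M.G θ j i := not_not.1 hadj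
          simp only [t]
          rw [show M.G θ₀ j i = 0 from hz θ₀ hθ₀, show M.G θ₁ j i = 0 from hz θ₁ hθ₁, zero_smul,
            zero_smul, sub_self]
      rw [h0]
      exact Submodule.zero_mem _
  have hd : ∑ i : Nstar, (M.G θ₀ j i - M.G θ₁ j i) • M.transferRow Xbar θ₀ i ∈
      M.transferSpan Xbar Cbar θ₀ := by
    have h1 := Fintype.sum_subtype_add_sum_subtype (fun i => i ∈ Nstar) t
    rw [ht] at h1
    have h2 : ∑ i : Nstar, (M.G θ₀ j i - M.G θ₁ j i) • M.transferRow Xbar θ₀ i =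
        ∑ i : {i // i ∈ Nstar}, t i := by
      refine Finset.sum_congr rfl fun i _ => ?_
      simp only [t]
      rw [← hmeas i (hNstarMeasured i.2), sub_smul]
    rw [h2, eq_neg_of_add_eq_zero_left h1]
    exact Submodule.neg_mem _ (Submodule.sum_mem _ fun i _ => htY i i.2)
  have hsup : M.transferSpan Xbar Cbar θ₀ ⊔
      Submodule.span (RatFunc ℝ) (M.transferRow Xbar θ₀ '' Nstar) =
      M.transferSpan Xbar (M.inNeighbors j ∪ Cbar) θ₀ := by
    rw [← hspan₀, DynNet.ModelSet.transferSpan, DynNet.ModelSet.transferSpan,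
      ← Submodule.span_union, ← Set.image_union, hY]
    congr 2
    rw [Set.union_right_comm, Set.sdiff_union_of_subset hNstar]
  intro i hi
  -- With `p = b(Xbar → Y)`, the sum of the two spans has dimension at least `b(Xbar → inNeighbors j
  -- ∪ Cbar)`, which equals `p + |Nstar|`.
  refine sub_eq_zero.1 (DynNet.coeff_eq_zero_of_finrank_sup (M.transferRow Xbar θ₀) Nstar
    (M.transferSpan Xbar Cbar θ₀) (p := M.b Xbar Y) ?_ ?_
    (fun i => M.G θ₀ j i - M.G θ₁ j i) hd ⟨i, hi⟩)
  · rw [← hspan₀]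
    exact DynNet.ModelSet.finrank_transferSpan_le_b hθ₀ (hdet θ₀ hθ₀) Xbar Y
  · rw [hsup, ← Nat.card_eq_fintype_card, Nat.card_coe_set_eq, ← hPathsNstar, ← hPaths]
    exact hN
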